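/- **Setting.** Let $H_{\mathbb R}$ be a separable real Hilbert space with complexification $H$ (inner product antilinear on the left), let $x\mapsto\bar x$ be a bounded linear self-adjoint operator on $H$ with $\bar{\bar x}=x$, let $T_x$ ($x\in H_{\mathbb R}$) be bounded self-adjoint operators on $H$, and let $\alpha,q\in(-1,1)$. On the algebraic full Fock space $\bigoplus_{n\ge 0}H^{\otimes n}$, with $H^{\otimes 0}=\mathbb C\Omega$, define for an operator $A$ on $H$ and $x\in H$ $$b^*(x)(x_1\otimes\cdots\otimes x_n)=x_1\otimes\cdots\otimes x_n\otimes x,\qquad b^*(x)\Omega=x,$$ $$r_q(x)(x_1\otimes\cdots\otimes x_n)=\sum_{k=1}^n q^{n-k}\langle x,x_k\rangle\,x_1\otimes\cdots\check x_k\cdots\otimes x_n,\qquad \ell^N_q(x)(x_1\otimes\cdots\otimes x_n)=q^{n-1}\sum_{k=1}^n q^{k-1}\langle x,\bar x_k\rangle\,x_1\otimes\cdots\check x_k\cdots\otimes x_n,$$ $$r_q^{A}=p_0(A)\Big(1+\sum_{k=1}^{n-1}q^k\pi_{n-1}\cdots\pi_{n-k}\Big),\qquad \ell_q^{N,A}=p_0(A)\,q^{n-1}\pi_{n-1}\cdots\pi_1\pi_0\Big(1+\sum_{k=1}^{n-1}q^k\pi_1\cdots\pi_k\Big)\quad\text{on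 }H^{\otimes n},\ n\ge 1,$$ where $p_0(A)$ applies $A$ to the last factor, $\pi_0$ applies the involution to the first factor, and $\pi_i$ exchanges the factors $i$ and $i+1$; the operators $r_q(x),\ell^N_q(x),r_q^A,\ell_q^{N,A}$ send $\Omega$ to $0$. Put $$b^{*}_{\alpha,q}(x)=b^*(x),\qquad b^{1}_{\alpha,q}(x)=r_q(x)+\alpha\ell_q^N(x),\qquad b^{\prime}_{\alpha,q}(x)=r_q^{T_x}+\alpha\ell_q^{N,T_x}.$$ **Partitions.** An extended type-B partition $\pi_f$ of $[n]=\{1,\dots,n\}$ is a set partition $\pi$ of $[n]$, a colouring $f$ of its arcs (pairs $i<j$ of consecutive elements of a block) by $\pm1$, and a choice of some blocks of size at least two, which are marked by $\prime$. Let $Sing$, $Block'$, $Block$ be the sets of singletons, of marked blocks, and of unmarked blocks of size at least two. For $\epsilon\in\{1,*,\prime\}^n$ let $\mathcal P^B_{E;\epsilon}(n)$ be the set of those $\pi_f$ for which $\epsilon(i)=*$ exactly if $i$ is the least element of its block, $\epsilon(i)=1$ exactly if $i$ is the largest element of a block in $Block$, and $\epsilon(i)=\prime$ for all other $i$. Define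 - $\mathrm{Narc}(\pi_f)$: the number of arcs of colour $-1$ (negative arcs); - $\mathrm{rc}(\pi)$: the number of crossing pairs of arcs, $i<i'<j<j'$ for arcs $\{i,j\},\{i',j'\}$; - $\mathrm{rnarc}(\pi_f)$: the number of pairs of an arc $\{i,j\}$ and a negative arc $\{i',j'\}$ with $i<i'<j'<j$; - $\mathrm{MaxC}(\pi)$: the number of pairs of a block $V\in Block'\cup Sing$ and an arc $\{i<j\}$ with $i<\max V<j$; - $\mathrm{MaxL}(\pi_f)$: the number of pairs of a block $V\in Block'\cup Sing$ and a negative arc $\{i<j\}$ with $\max V<i$. For $\mathbf x=(x_1,\dots,x_n)\in H_{\mathbb R}^n$ and a block $B=\{i_1<\dots<i_m\}$ let $f_j$ be the identity or $x\mapsto\bar x$ according to whether the arc $\{i_j,i_{j+1}\}$ has colour $1$ or $-1$, and let $$\widehat{\mathbf T}_B=T_{x_{i_m}}f_{m-1}\cdots T_{x_{i_2}}f_1\ \ (\text{the identity if } m=1),\qquad \mathbf T_B=f_{m-1}T_{x_{i_{m-1}}}\cdots f_2T_{x_{i_2}}f_1\ \ (m\ge 2),$$ $$\mathrm R^{\mathbf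 x}_{\pi_f}=\prod_{B\in Block}\langle x_{\max B},\mathbf T_Bx_{\min B}\rangle,\qquad \widehat{\mathrm R}^{\mathbf x}_{\pi_f}=\bigotimes_{B\in Block'\cup Sing}\widehat{\mathbf T}_Bx_{\min B},$$ where the tensor factors are ordered by increasing $\max B$ and the empty tensor product is $\Omega$. **Theorem.** For all $n$, all $\mathbf x=(x_1,\dots,x_n)\in H_{\mathbb R}^n$ and all $\epsilon=(\epsilon(1),\dots,\epsilon(n))\in\{1,*,\prime\}^n$, $$b_{\alpha,q}^{\epsilon(n)}(x_n)\cdots b_{\alpha,q}^{\epsilon(1)}(x_1)\Omega=\sum_{\pi_f\in\mathcal P^B_{E;\epsilon}(n)}\alpha^{\mathrm{Narc}(\pi_f)}\,q^{\mathrm{rc}(\pi)+\mathrm{MaxC}(\pi)+2\,\mathrm{rnarc}(\pi_f)+2\,\mathrm{MaxL}(\pi_f)}\,\mathrm R^{\mathbf x}_{\pi_f}\,\widehat{\mathrm R}^{\mathbf x}_{\pi_f},$$ an empty sum being $0$. -/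

import Mathlib

open scoped TensorProduct DirectSum

noncomputable section

namespace TypeB

/-! ### The one-particle space -/

/-- `ι : HR → H` exhibits the complex Hilbert space `H` as the complexification of the real
Hilbert space `HR`: inner products of real vectors agree, and every vector of `H` is `a + i b`
with `a`, `b` real. -/
structure IsComplexification {HR H : Type*} [NormedAddCommGroup HR] [InnerProductSpace ℝ HR]
    [NormedAddCommGroup H] [InnerProductSpace ℂ H] (ι : HR →ₗ[ℝ] H) : Prop where
  inner_map : ∀ a b : HR, inner ℂ (ι a) (ι b) = ((inner ℝ a b : ℝ) : ℂ)
  exists_re_im : ∀ z : H, ∃ a b : HR, z = ι a + Complex.I • ι b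

variable {H : Type*} [NormedAddCommGroup H] [InnerProductSpace ℂ H]

/-! ### The algebraic full Fock space -/

/-- The algebraic full Fock space `⨁ₙ H^{⊗n}` (no completion is taken). -/
abbrev Fock (H : Type*) [NormedAddCommGroup H] [InnerProductSpace ℂ H] : Type _ :=
  ⨁ n : ℕ, ⨂[ℂ]^n H

/-- The elementary tensor `x₁ ⊗ ⋯ ⊗ xₘ`, as a vector of the Fock space. -/
def pureTensor (l : List H) : Fock H :=
  DirectSum.lof ℂ ℕ (fun n => ⨂[ℂ]^n H) l.length (PiTensorProduct.tprod ℂ l.get)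

/-- The vacuum vector `Ω`, i.e. the empty elementary tensor. -/
def vacuum : Fock H := pureTensor []

/-- The linear map of the Fock space that acts as `A n` on `H^{⊗(n+1)}` and sends `Ω` to `0`. -/
def ofLevels {E : Type*} [AddCommMonoid E] [Module ℂ E]
    (A : ∀ n : ℕ, ⨂[ℂ]^(n + 1) H →ₗ[ℂ] E) : Fock H →ₗ[ℂ] E :=
  DirectSum.toModule ℂ ℕ E fun n =>
    match n with
    | 0 => 0
    | n + 1 => A n

/-- `x₀ ⊗ ⋯ ⊗ xₙ ↦ φ(xₖ) • x₀ ⊗ ⋯ ⊗ x̌ₖ ⊗ ⋯ ⊗ xₙ`. -/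
def contract {n : ℕ} (φ : H →ₗ[ℂ] ℂ) (k : Fin (n + 1)) : ⨂[ℂ]^(n + 1) H →ₗ[ℂ] ⨂[ℂ]^n H :=
  PiTensorProduct.lift
    (LinearMap.uncurryMid (M := fun _ : Fin (n + 1) => H) k
      (φ.smulRight (PiTensorProduct.tprod ℂ (s := fun _ : Fin n => H))))

/-- `x₁ ⊗ ⋯ ⊗ xₙ ↦ x₁ ⊗ ⋯ ⊗ xₙ ⊗ x`. -/
def appendVec (n : ℕ) (x : H) : ⨂[ℂ]^n H →ₗ[ℂ] ⨂[ℂ]^(n + 1) H :=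
  PiTensorProduct.lift
    ((LinearMap.applyₗ (R := ℂ) x).compMultilinearMap
      (PiTensorProduct.tprod ℂ (s := fun _ : Fin (n + 1) => H)).curryRight)

/-- The creation operator of type B: `x₁ ⊗ ⋯ ⊗ xₙ ↦ x₁ ⊗ ⋯ ⊗ xₙ ⊗ x` and `Ω ↦ x`. -/
def creation (x : H) : Module.End ℂ (Fock H) :=
  DirectSum.toModule ℂ ℕ (Fock H) fun n =>
    DirectSum.lof ℂ ℕ (fun n => ⨂[ℂ]^n H) (n + 1) ∘ₗ appendVec n x

/-- `r_q(x)`: with `N = n + 1` and `k` counted from `0`, the weight `q^{N-k}` of the `k`-th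
summand becomes `q^{n-k}`. -/
def rOp (q : ℝ) (x : H) : Module.End ℂ (Fock H) :=
  ofLevels fun n => DirectSum.lof ℂ ℕ (fun n => ⨂[ℂ]^n H) n ∘ₗ
    ∑ k : Fin (n + 1), (q : ℂ) ^ (n - (k : ℕ)) • contract (innerₛₗ ℂ x) k

/-- `ℓ^N_q(x)`: with `N = n + 1` and `k` counted from `0`, the weight `q^{N-1} q^{k-1}` of the
`k`-th summand becomes `q^n q^k`. -/
def lOp (q : ℝ) (bar : H →L[ℂ] H) (x : H) : Module.End ℂ (Fock H) :=
  ofLevels fun n => DirectSum.lof ℂ ℕ (fun n => ⨂[ℂ]^n H) n ∘ₗ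
    ((q : ℂ) ^ n • ∑ k : Fin (n + 1),
      (q : ℂ) ^ (k : ℕ) • contract (innerₛₗ ℂ x ∘ₗ (bar : H →ₗ[ℂ] H)) k)

/-- The operator applying `A` to the tensor factor number `j` (counted from `0`). -/
def atFactor {n : ℕ} (A : H →L[ℂ] H) (j : Fin n) : Module.End ℂ (⨂[ℂ]^n H) :=
  PiTensorProduct.map (Function.update (fun _ => LinearMap.id) j (A : H →ₗ[ℂ] H))

/-- The generator `π_{i+1}` on `H^{⊗(n+1)}`: it exchanges the neighbouring factors `i`, `i+1`
(counted from `0`). -/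
def transp {n : ℕ} (i : Fin n) : Module.End ℂ (⨂[ℂ]^(n + 1) H) :=
  (PiTensorProduct.reindex ℂ (fun _ : Fin (n + 1) => H)
    (Equiv.swap i.castSucc i.succ)).toLinearMap

/-- With `N = n + 1`, the operator `π_{N-1} π_{N-2} ⋯ π_{N-k}` on `H^{⊗N}`. -/
def descProd (n k : ℕ) : Module.End ℂ (⨂[ℂ]^(n + 1) H) :=
  (((List.finRange n).reverse.take k).map transp).prod

/-- The operator `π₁ π₂ ⋯ π_k` on `H^{⊗(n+1)}`. -/
def ascProd (n k : ℕ) : Module.End ℂ (⨂[ℂ]^(n + 1) H) :=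
  (((List.finRange n).take k).map transp).prod

/-- `r_q^A = p₀(A) (1 + ∑_{k=1}^{N-1} q^k π_{N-1} ⋯ π_{N-k})` on `H^{⊗N}`, `N = n + 1`, where
`p₀(A)` applies `A` to the last factor; it sends `Ω` to `0`. -/
def rGauge (q : ℝ) (A : H →L[ℂ] H) : Module.End ℂ (Fock H) :=
  ofLevels fun n => DirectSum.lof ℂ ℕ (fun n => ⨂[ℂ]^n H) (n + 1) ∘ₗ
    (atFactor A (Fin.last n) *
      (1 + ∑ k ∈ Finset.Icc 1 n, (q : ℂ) ^ k • descProd n k))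

/-- `ℓ_q^{N,A} = p₀(A) q^{N-1} π_{N-1} ⋯ π₁ π₀ (1 + ∑_{k=1}^{N-1} q^k π₁ ⋯ π_k)` on `H^{⊗N}`,
`N = n + 1`, where `π₀` applies the involution to the first factor; it sends `Ω` to `0`. -/
def lGauge (q : ℝ) (bar A : H →L[ℂ] H) : Module.End ℂ (Fock H) :=
  ofLevels fun n => DirectSum.lof ℂ ℕ (fun n => ⨂[ℂ]^n H) (n + 1) ∘ₗ
    (atFactor A (Fin.last n) * ((q : ℂ) ^ n • (descProd n n * atFactor bar 0 *
      (1 + ∑ k ∈ Finset.Icc 1 n, (q : ℂ) ^ k • ascProd n k))))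

/-- The letters `1`, `∗`, `′`. -/
inductive Letter : Type
  | one
  | star
  | prime

/-- The operator `b^ε(x)`, where `A` is the operator `T_x`: `r_q(x) + α ℓ^N_q(x)` for `ε = 1`,
the creation operator for `ε = ∗`, and `r_q^A + α ℓ_q^{N,A}` for `ε = ′`. -/
def bOp (α q : ℝ) (bar : H →L[ℂ] H) (x : H) (A : H →L[ℂ] H) :
    Letter → Module.End ℂ (Fock H)
  | .one => rOp q x + (α : ℂ) • lOp q bar x
  | .star => creation x
  | .prime => rGauge q A + (α : ℂ) • lGauge q bar A

/-! ### Extended partitions of type B -/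

/-- The arcs of a block: the pairs of consecutive elements. -/
def blockArcs {n : ℕ} (B : Finset (Fin n)) : Finset (Fin n × Fin n) :=
  {a ∈ B ×ˢ B | a.1 < a.2 ∧ ∀ k ∈ B, ¬ (a.1 < k ∧ k < a.2)}

/-- The arcs of a set partition. -/
def arcs {n : ℕ} (π : Finpartition (Finset.univ : Finset (Fin n))) : Finset (Fin n × Fin n) :=
  π.parts.biUnion blockArcs

/-- An extended type-B partition of `{1, …, n}` (indexed by `Fin n`): a set partition, a colouring
of its arcs by `±1`, given by the set of arcs of colour `-1` (the other arcs, and all singletons,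
have colour `1`), and a set of blocks of size at least two that are marked by a prime. -/
@[ext]
structure ExtPartition (n : ℕ) where
  part : Finpartition (Finset.univ : Finset (Fin n))
  negArcs : Finset (Fin n × Fin n)
  marked : Finset (Finset (Fin n))
  negArcs_subset : negArcs ⊆ arcs part
  marked_subset : marked ⊆ {B ∈ part.parts | 2 ≤ B.card}

namespace ExtPartition

variable {n : ℕ}

instance : Fintype (ExtPartition n) :=
  Fintype.ofInjective
    (fun π : ExtPartition n => (π.part, π.negArcs, π.marked))
    (fun π σ h => by
      simp only [Prod.mk.injEq] at h
      exact ExtPartition.ext h.1 h.2.1 h.2.2)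

/-- The block that contains `i`. -/
def blockOf (π : ExtPartition n) (i : Fin n) : Finset (Fin n) := π.part.part i

/-- The largest elements of the blocks in `Block'(π) ∪ Sing(π)`. -/
def openEnds (π : ExtPartition n) : Finset (Fin n) :=
  {i | (∀ j ∈ π.blockOf i, j ≤ i) ∧ (π.blockOf i ∈ π.marked ∨ (π.blockOf i).card = 1)}

/-- The largest elements of the blocks in `Block(π)`, the unmarked blocks of size at least two. -/
def closedEnds (π : ExtPartition n) : Finset (Fin n) :=
  {i | (∀ j ∈ π.blockOf i, j ≤ i) ∧ π.blockOf i ∉ π.marked ∧ 2 ≤ (π.blockOf i).card}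

/-- The number of negative arcs. -/
def Narc (π : ExtPartition n) : ℕ := π.negArcs.card

/-- The number of restricted crossings: every crossing pair of arcs is counted once, with the arc
that starts first as `p.1`. (Arcs of one block never cross.) -/
def rc (π : ExtPartition n) : ℕ :=
  Finset.card {p ∈ arcs π.part ×ˢ arcs π.part |
    p.1.1 < p.2.1 ∧ p.2.1 < p.1.2 ∧ p.1.2 < p.2.2}

/-- The number of restricted negative nestings: pairs of an arc and a negative arc nested by it.
(Arcs of one block never nest.) -/
def rnarc (π : ExtPartition n) : ℕ :=
  Finset.card {p ∈ arcs π.part ×ˢ π.negArcs | p.1.1 < p.2.1 ∧ p.2.2 < p.1.2}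

/-- The number of pairs `(V, W)` of a block `V ∈ Block'(π) ∪ Sing(π)` and an arc `W` that covers
`max V`; blocks are represented by their largest elements. -/
def MaxC (π : ExtPartition n) : ℕ :=
  Finset.card {p ∈ π.openEnds ×ˢ arcs π.part | p.2.1 < p.1 ∧ p.1 < p.2.2}

/-- The number of pairs `(V, W)` of a block `V ∈ Block'(π) ∪ Sing(π)` and a negative arc `W` such
that `max V` is to the left of `W`; blocks are represented by their largest elements. -/
def MaxL (π : ExtPartition n) : ℕ :=
  Finset.card {p ∈ π.openEnds ×ˢ π.negArcs | p.1 < p.2.1 ∧ p.1 < p.2.2}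

/-- Compatibility with the word `ε`: the least element of every block carries the letter `∗`, the
largest element of every block in `Block(π)` carries `1`, and all other elements (those strictly
inside a block, and the largest elements of marked blocks) carry `′`. -/
def Compatible (π : ExtPartition n) (ε : Fin n → Letter) : Prop :=
  ∀ i : Fin n,
    (ε i = Letter.star ↔ ∀ j ∈ π.blockOf i, i ≤ j) ∧
    (ε i = Letter.one ↔ i ∈ π.closedEnds) ∧
    (ε i = Letter.prime ↔ (∃ j ∈ π.blockOf i, j < i) ∧
      ((∃ j ∈ π.blockOf i, i < j) ∨ π.blockOf i ∈ π.marked))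

open Classical in
/-- The extended type-B partitions that are compatible with the word `ε`. -/
def ofWord (ε : Fin n → Letter) : Finset (ExtPartition n) := {π | π.Compatible ε}

/-- The colour operator of the arc `(i, j)`. -/
def colorOp (bar : H →L[ℂ] H) (π : ExtPartition n) (i j : Fin n) : H →L[ℂ] H :=
  if (i, j) ∈ π.negArcs then bar else ContinuousLinearMap.id ℂ H

/-- For a block with elements `i₁ < ⋯ < iₘ`, listed as `[iₘ, …, i₁]`, the operator
`A_{iₘ} f_{m-1} ⋯ A_{i₃} f₂ A_{i₂} f₁` (the identity if `m = 1`), where `A i` is `T_{x_i}`. -/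
def hatT (bar : H →L[ℂ] H) (A : Fin n → H →L[ℂ] H) (π : ExtPartition n) :
    List (Fin n) → H →L[ℂ] H
  | j :: i :: l => A j ∘L π.colorOp bar i j ∘L hatT bar A π (i :: l)
  | _ => ContinuousLinearMap.id ℂ H

/-- For a block with elements `i₁ < ⋯ < iₘ`, `m ≥ 2`, listed as `[iₘ, …, i₁]`, the operator
`f_{m-1} A_{i_{m-1}} ⋯ f₂ A_{i₂} f₁`. -/
def T (bar : H →L[ℂ] H) (A : Fin n → H →L[ℂ] H) (π : ExtPartition n) :
    List (Fin n) → H →L[ℂ] H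
  | j :: i :: l => π.colorOp bar i j ∘L hatT bar A π (i :: l)
  | _ => ContinuousLinearMap.id ℂ H

/-- The elements of the block of `i`, from the largest to the smallest. -/
def blockList (π : ExtPartition n) (i : Fin n) : List (Fin n) :=
  (π.blockOf i).sort (fun a b => b ≤ a)

/-- The least element of the block of `i`. -/
def blockMin (π : ExtPartition n) (i : Fin n) : Fin n :=
  (π.blockOf i).min' ⟨i, π.part.mem_part (Finset.mem_univ i)⟩

/-- The scalar `R_π = ∏ ⟨x_{max B}, T_B x_{min B}⟩`, the product over the blocks `B ∈ Block(π)`,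
which are represented by their largest elements. -/
def R (bar : H →L[ℂ] H) (x : Fin n → H) (A : Fin n → H →L[ℂ] H) (π : ExtPartition n) : ℂ :=
  ∏ i ∈ π.closedEnds, inner ℂ (x i) (T bar A π (π.blockList i) (x (π.blockMin i)))

/-- The tensor `R̂_π = ⊗ T̂_B x_{min B}` over the blocks `B ∈ Block'(π) ∪ Sing(π)`, in increasing
order of their largest elements; it is `Ω` if there are no such blocks. -/
def hatR (bar : H →L[ℂ] H) (x : Fin n → H) (A : Fin n → H →L[ℂ] H) (π : ExtPartition n) :
    Fock H :=
  pureTensor ((π.openEnds.sort (fun a b => a ≤ b)).map fun i =>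
    hatT bar A π (π.blockList i) (x (π.blockMin i)))

end ExtPartition

end TypeB

end

/-! The proof is an induction on the length of the word: applying the next operator to the formula
for `n` letters gives, term by term, the formula for `n + 1` letters.

A compatible word determines the marks: the marked blocks are the blocks of size at least two
without a letter `1` (`Fits.compatible`, `ExtPartition.Compatible.extOf_eq`). Hence the sum runs
over pairs of a set partition fitting the word and a set `N` of negative arcs (`sum_ofWord`). The
tensor factors of a term are indexed by its open ends, the block maxima not carrying `1`.

A letter `∗` adds a singleton. Any other letter joins the new last point to the block of an open end
`k`, by an arc of either colour; `sum_fitting_star` and `sum_fitting_join` show that each partition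
of `n + 1` points arises exactly once. On the operator side, `bOp_one_tens` and `bOp_prime_tens`
expand `b^1` and `b^′` as sums over the same pairs (factor `k`, colour). With `a` factors to the
right of `k` and `b` to the left, the weight is `q^a` for a positive arc and `α q^(a + 2b)` for a
negative one.

The statistics change by the same amounts (`qExp_insert_pos`, `qExp_insert_neg`). Arcs covering `k`
move from MaxC to crossings with the new arc, and negative arcs right of `k` move from MaxL to
nestings inside it, so both totals are preserved. What is gained is the `a` open ends covered by the
new arc and, if it is negative, twice the `b` open ends to its left. -/

noncomputable section

namespace TypeB

variable {H : Type*} [NormedAddCommGroup H] [InnerProductSpace ℂ H]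

/-! ### Elementary tensors -/

/-- The elementary tensor `v 0 ⊗ ⋯ ⊗ v (n - 1)`. -/
def pureFn {n : ℕ} (v : Fin n → H) : Fock H :=
  DirectSum.lof ℂ ℕ (fun n => ⨂[ℂ]^n H) n (PiTensorProduct.tprod ℂ v)

/-- Transport along an equality of degrees is needed because the length of `List.ofFn v` is `n` only
propositionally. -/
theorem pureFn_cast {m n : ℕ} (h : m = n) (v : Fin n → H) :
    pureFn (v ∘ Fin.cast h) = pureFn v := by
  subst h; rfl

theorem pureTensor_ofFn {n : ℕ} (v : Fin n → H) : pureTensor (List.ofFn v) = pureFn v := by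
  have h : (List.ofFn v).get = v ∘ Fin.cast (List.length_ofFn) := by
    ext i; simp; rfl
  rw [← pureFn_cast (List.length_ofFn (f := v)) v, ← h]; rfl

theorem ofFn_snoc {β : Type*} {n : ℕ} (v : Fin n → β) (y : β) :
    List.ofFn (Fin.snoc v y : Fin (n + 1) → β) = List.ofFn v ++ [y] := by
  rw [List.ofFn_succ']; simp [List.concat_eq_append]

theorem pureFn_zero (v : Fin 0 → H) : pureFn v = vacuum := by
  rw [← pureTensor_ofFn]; simp [vacuum]

/-- The effect of the operator with components `A n` on elementary tensors. -/
theorem ofLevels_pureFn {E : Type*} [AddCommMonoid E] [Module ℂ E]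
    (A : ∀ n : ℕ, ⨂[ℂ]^(n + 1) H →ₗ[ℂ] E) {n : ℕ} (v : Fin (n + 1) → H) :
    ofLevels A (pureFn v) = A n (PiTensorProduct.tprod ℂ v) := by
  simp [ofLevels, pureFn]

theorem ofLevels_vacuum {E : Type*} [AddCommMonoid E] [Module ℂ E]
    (A : ∀ n : ℕ, ⨂[ℂ]^(n + 1) H →ₗ[ℂ] E) : ofLevels A vacuum = 0 := by
  rw [← pureFn_zero ![]]; simp [ofLevels, pureFn]

theorem contract_tprod {n : ℕ} (φ : H →ₗ[ℂ] ℂ) (k : Fin (n + 1)) (v : Fin (n + 1) → H) :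
    contract φ k (PiTensorProduct.tprod ℂ v) =
      φ (v k) • PiTensorProduct.tprod ℂ (k.removeNth v) := by
  simp [contract]

theorem creation_pureTensor (x : H) (l : List H) :
    creation x (pureTensor l) = pureTensor (l ++ [x]) := by
  obtain ⟨n, v, rfl⟩ : ∃ (n : ℕ) (v : Fin n → H), l = List.ofFn v :=
    ⟨l.length, l.get, by simp⟩
  rw [← ofFn_snoc, pureTensor_ofFn, pureTensor_ofFn]
  simp [creation, pureFn, appendVec]

theorem rOp_pureFn (q : ℝ) (x : H) {n : ℕ} (v : Fin (n + 1) → H) :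
    rOp q x (pureFn v) =
      ∑ k : Fin (n + 1), ((q : ℂ) ^ (n - (k : ℕ)) * inner ℂ x (v k)) •
        pureFn (k.removeNth v) := by
  rw [rOp, ofLevels_pureFn]
  simp [contract_tprod, map_sum, smul_smul, pureFn]

theorem lOp_pureFn (q : ℝ) (bar : H →L[ℂ] H) (x : H) {n : ℕ} (v : Fin (n + 1) → H) :
    lOp q bar x (pureFn v) =
      ∑ k : Fin (n + 1), ((q : ℂ) ^ (n + (k : ℕ)) * inner ℂ x (bar (v k))) •
        pureFn (k.removeNth v) := by
  rw [lOp, ofLevels_pureFn]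
  simp [contract_tprod, map_sum, smul_smul, pureFn, Finset.smul_sum, pow_add, mul_assoc]

theorem transp_tprod {n : ℕ} (i : Fin n) (v : Fin (n + 1) → H) :
    transp i (PiTensorProduct.tprod ℂ v) =
      PiTensorProduct.tprod ℂ (v ∘ Equiv.swap i.castSucc i.succ) := by
  simp only [transp, LinearEquiv.coe_coe, PiTensorProduct.reindex_tprod, Equiv.symm_swap]
  rfl

theorem atFactor_tprod {n : ℕ} (A : H →L[ℂ] H) (j : Fin n) (v : Fin n → H) :
    atFactor A j (PiTensorProduct.tprod ℂ v) =
      PiTensorProduct.tprod ℂ (Function.update v j (A (v j))) := by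
  rw [atFactor, PiTensorProduct.map_tprod]
  congr 1
  ext i
  by_cases h : i = j
  · subst h; simp
  · simp [h]

/-- The exchange puts the entry `v p` at position `p + 1` and keeps the order of all other entries,
so deleting it afterwards or beforehand leaves the same tuple. -/
theorem removeNth_succ_swap {β : Type*} {n : ℕ} (p : Fin n) (v : Fin (n + 1) → β) :
    p.succ.removeNth (v ∘ Equiv.swap p.castSucc p.succ) = p.castSucc.removeNth v := by
  ext i
  simp only [Fin.removeNth_apply, Function.comp_apply]
  congr 1
  rcases lt_trichotomy i p with h | rfl | h
  · have h' : (i : ℕ) < p := h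
    rw [Fin.succAbove_of_castSucc_lt _ _ (Fin.lt_def.2 (by simp; omega)),
      Fin.succAbove_of_castSucc_lt _ _ (by simpa using h),
      Equiv.swap_apply_of_ne_of_ne] <;> simp only [ne_eq, Fin.ext_iff, Fin.val_castSucc,
        Fin.val_succ] <;> omega
  · simp
  · have h' : (p : ℕ) < i := h
    rw [Fin.succAbove_of_lt_succ _ _ (by simpa using h),
      Fin.succAbove_of_lt_succ _ _ (Fin.lt_def.2 (by simp; omega)),
      Equiv.swap_apply_of_ne_of_ne] <;> simp only [ne_eq, Fin.ext_iff, Fin.val_castSucc,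
        Fin.val_succ] <;> omega

theorem removeNth_castSucc_swap {β : Type*} {n : ℕ} (p : Fin n) (v : Fin (n + 1) → β) :
    p.castSucc.removeNth (v ∘ Equiv.swap p.castSucc p.succ) = p.succ.removeNth v := by
  rw [← removeNth_succ_swap, Function.comp_assoc]
  simp [← Equiv.coe_trans]

/-- With indices from `0`, the left side is the product of the `transp i` for `i` from `n - 1` down
to `p`. Its rightmost factor acts first, which suits a reverse induction on `p`. -/
theorem descProd_succ {n : ℕ} (p : Fin n) :
    descProd (H := H) n (n - p) = descProd n (n - (p + 1)) * transp p := by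
  have h : n - (p : ℕ) = n - (p + 1) + 1 := by omega
  rw [descProd, descProd, h, List.take_add_one]
  have : (List.finRange n).reverse[n - (↑p + 1)]? = some p := by
    rw [List.getElem?_eq_getElem (by simp; omega)]
    simp [Fin.ext_iff]; omega
  simp [this]

theorem ascProd_succ {n : ℕ} (p : Fin n) :
    ascProd (H := H) n (p + 1) = ascProd n p * transp p := by
  rw [ascProd, ascProd, List.take_add_one]
  simp

/-- `π_{N-1} ⋯ π_j` moves the factor number `j` to the end. -/
theorem descProd_tprod {n : ℕ} (j : Fin (n + 1)) (v : Fin (n + 1) → H) :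
    descProd n (n - j) (PiTensorProduct.tprod ℂ v) =
      PiTensorProduct.tprod ℂ (Fin.snoc (j.removeNth v) (v j) : Fin (n + 1) → H) := by
  induction j using Fin.reverseInduction generalizing v with
  | last =>
    simp [descProd]
  | cast p ih =>
    have := ih (v ∘ Equiv.swap p.castSucc p.succ)
    rw [Fin.val_succ, removeNth_succ_swap] at this
    rw [Fin.val_castSucc, descProd_succ, Module.End.mul_apply, transp_tprod, this]
    simp

/-- `π₁ ⋯ π_j` moves the factor number `j` to the front. -/
theorem ascProd_tprod {n : ℕ} (j : Fin (n + 1)) (v : Fin (n + 1) → H) :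
    ascProd n j (PiTensorProduct.tprod ℂ v) =
      PiTensorProduct.tprod ℂ (Fin.cons (v j) (j.removeNth v) : Fin (n + 1) → H) := by
  induction j using Fin.induction generalizing v with
  | zero =>
    simp [ascProd]
  | succ p ih =>
    have := ih (v ∘ Equiv.swap p.castSucc p.succ)
    rw [Fin.val_castSucc, removeNth_castSucc_swap] at this
    rw [Fin.val_succ, ascProd_succ, Module.End.mul_apply, transp_tprod, this]
    simp

/-- The summand `1` is the missing `k = 0` term, an empty product of transpositions. -/
theorem one_add_sum_pow_smul {M : Type*} [Ring M] [Module ℂ M] (q : ℂ) (n : ℕ) (D : ℕ → M)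
    (h : D 0 = 1) :
    1 + ∑ k ∈ Finset.Icc 1 n, q ^ k • D k = ∑ k : Fin (n + 1), q ^ (k : ℕ) • D k := by
  rw [Fin.sum_univ_eq_sum_range (fun k => q ^ k • D k), Finset.sum_range_succ', add_comm, h,
    pow_zero, one_smul, Finset.range_eq_Ico,
    Finset.sum_Ico_add' (fun k => q ^ k • D k) 0 n 1]
  rfl

theorem rGauge_pureFn (q : ℝ) (A : H →L[ℂ] H) {n : ℕ} (v : Fin (n + 1) → H) :
    rGauge q A (pureFn v) =
      ∑ k : Fin (n + 1), (q : ℂ) ^ (n - (k : ℕ)) •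
        pureFn (Fin.snoc (k.removeNth v) (A (v k)) : Fin (n + 1) → H) := by
  -- The `k`-th summand moves factor `n - k` to the end; the reversal reindexes the sum by the moved
  -- factor.
  rw [rGauge, ofLevels_pureFn, one_add_sum_pow_smul _ _ _ (by simp [descProd]),
    ← Equiv.sum_comp Fin.revPerm]
  simp only [LinearMap.comp_apply, Module.End.mul_apply, LinearMap.sum_apply, map_sum,
    LinearMap.smul_apply, map_smul]
  refine Finset.sum_congr rfl fun k _ => ?_
  have h : ((Fin.revPerm k : Fin (n + 1)) : ℕ) = n - k := by simp
  rw [h, descProd_tprod, atFactor_tprod, Fin.update_snoc_last]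
  simp [pureFn]

/-- Factor `k` is brought to the front at cost `q^k`, meets the involution there, and is then
carried to the end at cost `q^n`, where `A` acts. -/
theorem lGauge_pureFn (q : ℝ) (bar A : H →L[ℂ] H) {n : ℕ} (v : Fin (n + 1) → H) :
    lGauge q bar A (pureFn v) =
      ∑ k : Fin (n + 1), (q : ℂ) ^ (n + (k : ℕ)) •
        pureFn (Fin.snoc (k.removeNth v) (A (bar (v k))) : Fin (n + 1) → H) := by
  rw [lGauge, ofLevels_pureFn, one_add_sum_pow_smul _ _ _ (by simp [ascProd])]
  simp only [LinearMap.comp_apply, Module.End.mul_apply, LinearMap.sum_apply, map_sum,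
    LinearMap.smul_apply, map_smul, Finset.smul_sum]
  refine Finset.sum_congr rfl fun k _ => ?_
  have h := descProd_tprod (0 : Fin (n + 1)) (Fin.cons (bar (v k)) (k.removeNth v))
  rw [Fin.val_zero, Nat.sub_zero] at h
  rw [ascProd_tprod, atFactor_tprod, Fin.cons_zero, Fin.update_cons_zero, h, atFactor_tprod,
    Fin.update_snoc_last]
  simp [pureFn, pow_add, smul_smul]

/-! ### Elementary tensors indexed by finite sets -/

/-- The elementary tensor `⊗_{i ∈ S} v i`, in increasing order of the indices. -/
def tens {m : ℕ} (v : Fin m → H) (S : Finset (Fin m)) : Fock H :=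
  pureTensor ((S.sort (fun a b => a ≤ b)).map v)

theorem sort_map_eq_ofFn {β : Type*} {m n : ℕ} (v : Fin m → β) (S : Finset (Fin m))
    (h : S.card = n) :
    (S.sort (fun a b => a ≤ b)).map v = List.ofFn (v ∘ S.orderEmbOfFin h) := by
  rw [← Finset.listMap_orderEmbOfFin_finRange S h, List.map_map, List.ofFn_eq_map]

/-- Positions in a tensor have to become counts of indices on either side, since the partition
statistics are such counts. -/
theorem card_orderEmb_lt {m n : ℕ} (S : Finset (Fin m)) (h : S.card = n) (k : Fin n) :
    (S.filter (· < S.orderEmbOfFin h k)).card = k := by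
  rw [← Fin.card_Iio k, ← Finset.card_map (S.orderEmbOfFin h).toEmbedding]
  congr 1
  ext i
  simp only [Finset.mem_filter, Finset.mem_map, Finset.mem_Iio]
  constructor
  · rintro ⟨hi, hlt⟩
    rw [← Finset.mem_coe, ← S.range_orderEmbOfFin h] at hi
    obtain ⟨j, rfl⟩ := hi
    exact ⟨j, by simpa using hlt, rfl⟩
  · rintro ⟨j, hj, rfl⟩
    exact ⟨S.orderEmbOfFin_mem h j, by simpa using hj⟩

theorem card_orderEmb_gt {m n : ℕ} (S : Finset (Fin m)) (h : S.card = n + 1)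
    (k : Fin (n + 1)) :
    (S.filter (S.orderEmbOfFin h k < ·)).card = n - k := by
  have e : n - (k : ℕ) = (Finset.Ioi k).card := by rw [Fin.card_Ioi]; omega
  rw [e, ← Finset.card_map (S.orderEmbOfFin h).toEmbedding]
  congr 1
  ext i
  simp only [Finset.mem_filter, Finset.mem_map, Finset.mem_Ioi]
  constructor
  · rintro ⟨hi, hlt⟩
    rw [← Finset.mem_coe, ← S.range_orderEmbOfFin h] at hi
    obtain ⟨j, rfl⟩ := hi
    exact ⟨j, by simpa using hlt, rfl⟩
  · rintro ⟨j, hj, rfl⟩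
    exact ⟨S.orderEmbOfFin_mem h j, by simpa using hj⟩

theorem sort_erase_map {β : Type*} {m n : ℕ} (v : Fin m → β) (S : Finset (Fin m))
    (h : S.card = n + 1) (k : Fin (n + 1)) :
    ((S.erase (S.orderEmbOfFin h k)).sort (fun a b => a ≤ b)).map v =
      List.ofFn (k.removeNth (v ∘ S.orderEmbOfFin h)) := by
  have hc : (S.erase (S.orderEmbOfFin h k)).card = n := by
    rw [Finset.card_erase_of_mem (S.orderEmbOfFin_mem h k), h]; rfl
  rw [sort_map_eq_ofFn v _ hc, ← Finset.orderEmbOfFin_unique hc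
    (f := S.orderEmbOfFin h ∘ k.succAbove)]
  · rfl
  · intro i
    simp [Finset.orderEmbOfFin_mem]
  · exact (S.orderEmbOfFin h).strictMono.comp (Fin.strictMono_succAbove k)

/-- An operator that kills the vacuum and sums over the factors of an elementary tensor does so
for elementary tensors indexed by finite sets. -/
theorem map_tens (F : Module.End ℂ (Fock H)) (h0 : F vacuum = 0)
    (g : ℕ → ℕ → H → List H → Fock H)
    (hF : ∀ (n : ℕ) (v : Fin (n + 1) → H), F (pureFn v) =
      ∑ k : Fin (n + 1), g (n - k) k (v k) (List.ofFn (k.removeNth v)))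
    {m : ℕ} (v : Fin m → H) (S : Finset (Fin m)) :
    F (tens v S) = ∑ i ∈ S, g (S.filter (i < ·)).card (S.filter (· < i)).card (v i)
      (((S.erase i).sort (fun a b => a ≤ b)).map v) := by
  rcases h : S.card with _ | n
  · rw [Finset.card_eq_zero] at h
    subst h
    simpa [tens, vacuum] using h0
  · rw [tens, sort_map_eq_ofFn v S h, pureTensor_ofFn, hF]
    conv_rhs => rw [← Finset.map_orderEmbOfFin_univ S h, Finset.sum_map]
    refine Finset.sum_congr rfl fun k _ => ?_
    rw [Finset.map_orderEmbOfFin_univ S h]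
    simp only [RelEmbedding.coe_toEmbedding]
    rw [card_orderEmb_lt, card_orderEmb_gt, sort_erase_map]
    rfl

theorem creation_tens (x : H) {m : ℕ} (v : Fin m → H) (S : Finset (Fin m)) :
    creation x (tens v S) = pureTensor ((S.sort (fun a b => a ≤ b)).map v ++ [x]) :=
  creation_pureTensor _ _

/-- The coefficients of `r_q + α ℓ^N_q` at the two colours of a new arc. -/
def newWeight (α q : ℝ) (neg : Bool) (a b : ℕ) : ℂ :=
  if neg then (α : ℂ) * (q : ℂ) ^ (a + 2 * b) else (q : ℂ) ^ a

/-- The colour operator of a new arc. -/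
def newColor (bar : H →L[ℂ] H) (neg : Bool) : H →L[ℂ] H :=
  if neg then bar else ContinuousLinearMap.id ℂ H

theorem bOp_one_tens (α q : ℝ) (bar : H →L[ℂ] H) (x : H) (A : H →L[ℂ] H) {m : ℕ}
    (v : Fin m → H) (S : Finset (Fin m)) :
    bOp α q bar x A .one (tens v S) = ∑ i ∈ S, ∑ neg : Bool,
      (newWeight α q neg (S.filter (i < ·)).card (S.filter (· < i)).card *
        inner ℂ x (newColor bar neg (v i))) •
      pureTensor (((S.erase i).sort (fun a b => a ≤ b)).map v) := by
  refine map_tens _ ?_ (fun a b w l => ∑ neg : Bool,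
      (newWeight α q neg a b * inner ℂ x (newColor bar neg w)) • pureTensor l) ?_ v S
  · simp [bOp, rOp, lOp, ofLevels_vacuum]
  · intro n v
    simp only [bOp, LinearMap.add_apply, LinearMap.smul_apply, rOp_pureFn, lOp_pureFn,
      Finset.smul_sum, ← Finset.sum_add_distrib]
    refine Finset.sum_congr rfl fun k _ => ?_
    -- Here `n - k` factors stand to the right of factor `k` and `k` to its left, so the exponent of
    -- `ℓ^N_q` is `a + 2b`.
    have e : n + (k : ℕ) = n - k + 2 * k := by omega
    rw [pureTensor_ofFn, e]
    simp [newWeight, newColor, smul_smul, add_comm, mul_assoc]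

theorem bOp_prime_tens (α q : ℝ) (bar : H →L[ℂ] H) (x : H) (A : H →L[ℂ] H) {m : ℕ}
    (v : Fin m → H) (S : Finset (Fin m)) :
    bOp α q bar x A .prime (tens v S) = ∑ i ∈ S, ∑ neg : Bool,
      newWeight α q neg (S.filter (i < ·)).card (S.filter (· < i)).card •
      pureTensor (((S.erase i).sort (fun a b => a ≤ b)).map v ++
        [A (newColor bar neg (v i))]) := by
  refine map_tens _ ?_ (fun a b w l => ∑ neg : Bool,
      newWeight α q neg a b • pureTensor (l ++ [A (newColor bar neg w)])) ?_ v S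
  · simp [bOp, rGauge, lGauge, ofLevels_vacuum]
  · intro n v
    simp only [bOp, LinearMap.add_apply, LinearMap.smul_apply, rGauge_pureFn, lGauge_pureFn,
      Finset.smul_sum, ← Finset.sum_add_distrib]
    refine Finset.sum_congr rfl fun k _ => ?_
    have e : n + (k : ℕ) = n - k + 2 * k := by omega
    simp only [← ofFn_snoc, pureTensor_ofFn, e]
    simp [newWeight, newColor, smul_smul, add_comm]

/-! ### Set partitions of `Fin (n + 1)` and of `Fin n` -/

abbrev SetPartition (n : ℕ) := Finpartition (Finset.univ : Finset (Fin n))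

section SetPartition

variable {n : ℕ}

theorem mem_part_iff (P : SetPartition n) {i j : Fin n} : j ∈ P.part i ↔ P.part j = P.part i :=
  P.mem_part_iff_part_eq_part (Finset.mem_univ j) (Finset.mem_univ i)

theorem mem_part_refl (P : SetPartition n) (i : Fin n) : i ∈ P.part i :=
  P.mem_part (Finset.mem_univ i)

theorem mem_parts_iff (P : SetPartition n) {B : Finset (Fin n)} :
    B ∈ P.parts ↔ ∃ i, P.part i = B := by
  constructor
  · intro hB
    obtain ⟨i, hi⟩ := P.nonempty_of_mem_parts hB
    exact ⟨i, P.part_eq_of_mem hB hi⟩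
  · rintro ⟨i, rfl⟩
    exact P.part_mem.2 (Finset.mem_univ i)

theorem setPartition_ext {P Q : SetPartition n}
    (h : ∀ i j, j ∈ P.part i ↔ j ∈ Q.part i) : P = Q := by
  ext B
  simp only [mem_parts_iff, show P.part = Q.part from funext fun i => Finset.ext (h i)]

theorem mem_arcs (P : SetPartition n) {i j : Fin n} :
    (i, j) ∈ arcs P ↔ i < j ∧ j ∈ P.part i ∧ ∀ l ∈ P.part i, ¬ (i < l ∧ l < j) := by
  simp only [arcs, Finset.mem_biUnion, blockArcs, Finset.mem_filter, Finset.mem_product]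
  constructor
  · rintro ⟨B, hB, ⟨hi, hj⟩, hlt, h⟩
    obtain rfl := P.part_eq_of_mem hB hi
    exact ⟨hlt, hj, h⟩
  · rintro ⟨hlt, hj, h⟩
    exact ⟨P.part i, P.part_mem.2 (Finset.mem_univ i), ⟨mem_part_refl P i, hj⟩, hlt, h⟩

open Classical in
/-- The set partition into the fibres of a map. -/
def fibers {β : Type*} (f : Fin n → β) : SetPartition n := Finpartition.ofSetoid (Setoid.ker f)

theorem mem_part_fibers {β : Type*} (f : Fin n → β) {i j : Fin n} :
    j ∈ (fibers f).part i ↔ f i = f j := by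
  classical
  rw [fibers, Finpartition.mem_part_ofSetoid_iff_rel]
  rfl

/-- The set partition of `Fin (n + 1)` obtained by adding the last point to the block `B`; it is
added as a singleton if `B` is empty. -/
def addLast (P : SetPartition n) (B : Finset (Fin n)) : SetPartition (n + 1) :=
  fibers (Fin.snoc P.part B : Fin (n + 1) → Finset (Fin n))

/-- The restriction of a set partition of `Fin (n + 1)` to `Fin n`. -/
def dropLast (P : SetPartition (n + 1)) : SetPartition n := fibers fun i => P.part i.castSucc

theorem mem_part_dropLast (P : SetPartition (n + 1)) {i j : Fin n} :
    j ∈ (dropLast P).part i ↔ j.castSucc ∈ P.part i.castSucc := by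
  rw [dropLast, mem_part_fibers, mem_part_iff, eq_comm]

theorem castSucc_mem_part_addLast (P : SetPartition n) (B : Finset (Fin n)) {i j : Fin n} :
    j.castSucc ∈ (addLast P B).part i.castSucc ↔ j ∈ P.part i := by
  rw [addLast, mem_part_fibers, mem_part_iff, eq_comm]
  simp

theorem dropLast_addLast (P : SetPartition n) (B : Finset (Fin n)) :
    dropLast (addLast P B) = P :=
  setPartition_ext fun i j => by rw [mem_part_dropLast, castSucc_mem_part_addLast]

/-- `B` is a block of `P` or empty. -/
def IsBlockOrEmpty (P : SetPartition n) (B : Finset (Fin n)) : Prop :=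
  ∀ i, P.part i = B ↔ i ∈ B

theorem isBlockOrEmpty_part (P : SetPartition n) (k : Fin n) : IsBlockOrEmpty P (P.part k) :=
  fun _ => (mem_part_iff P).symm

theorem isBlockOrEmpty_empty (P : SetPartition n) : IsBlockOrEmpty P ∅ := fun i => by
  simp only [Finset.notMem_empty, iff_false]
  exact fun h => by simpa [h] using mem_part_refl P i

variable {P : SetPartition n} {B : Finset (Fin n)}

theorem IsBlockOrEmpty.last_mem (hB : IsBlockOrEmpty P B) {i : Fin n} :
    Fin.last n ∈ (addLast P B).part i.castSucc ↔ i ∈ B := by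
  rw [addLast, mem_part_fibers, ← hB]
  simp

theorem IsBlockOrEmpty.castSucc_mem (hB : IsBlockOrEmpty P B) {i : Fin n} :
    i.castSucc ∈ (addLast P B).part (Fin.last n) ↔ i ∈ B := by
  rw [addLast, mem_part_fibers, ← hB, eq_comm]
  simp

theorem IsBlockOrEmpty.part_castSucc (hB : IsBlockOrEmpty P B) {i : Fin n} (hi : i ∉ B) :
    (addLast P B).part i.castSucc = (P.part i).map Fin.castSuccEmb := by
  ext j
  refine Fin.lastCases ?_ (fun j => ?_) j
  · simp [hB.last_mem, hi]
  · simp [castSucc_mem_part_addLast]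

theorem IsBlockOrEmpty.part_last (hB : IsBlockOrEmpty P B) :
    (addLast P B).part (Fin.last n) = insert (Fin.last n) (B.map Fin.castSuccEmb) := by
  ext j
  refine Fin.lastCases ?_ (fun j => ?_) j
  · simp
  · simp [hB.castSucc_mem]

/-- The embedding of the arcs on `Fin n` into those on `Fin (n + 1)`. -/
def arcEmb (n : ℕ) : Fin n × Fin n ↪ Fin (n + 1) × Fin (n + 1) :=
  Fin.castSuccEmb.prodMap Fin.castSuccEmb

@[simp]
theorem arcEmb_apply (a : Fin n × Fin n) : arcEmb n a = (a.1.castSucc, a.2.castSucc) := rfl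

/-- The new point lies to the right of all old ones, so it never separates two of them. -/
theorem castSucc_mem_arcs_addLast (P : SetPartition n) (B : Finset (Fin n)) {i j : Fin n} :
    (i.castSucc, j.castSucc) ∈ arcs (addLast P B) ↔ (i, j) ∈ arcs P := by
  simp only [mem_arcs, Fin.castSucc_lt_castSucc_iff, castSucc_mem_part_addLast]
  refine and_congr_right fun _ => and_congr_right fun _ => ⟨fun h l hl => ?_, fun h l => ?_⟩
  · simpa using h l.castSucc ((castSucc_mem_part_addLast P B).2 hl)
  · refine Fin.lastCases (fun _ h' => ?_) (fun l hl => ?_) l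
    · exact absurd h'.2 (by simp [Fin.le_last])
    · simpa using h l ((castSucc_mem_part_addLast P B).1 hl)

theorem IsBlockOrEmpty.mem_arcs_last (hB : IsBlockOrEmpty P B) {i : Fin n} :
    (i.castSucc, Fin.last n) ∈ arcs (addLast P B) ↔ i ∈ B ∧ ∀ l ∈ B, l ≤ i := by
  simp only [mem_arcs, Fin.castSucc_lt_last, true_and, hB.last_mem]
  refine and_congr_right fun hi => ⟨fun h l hl => ?_, fun h l => ?_⟩
  · have := h l.castSucc ((castSucc_mem_part_addLast P B).2 ?_)
    · simpa [Fin.castSucc_lt_last] using this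
    · rw [← (hB i).2 hi] at hl; exact hl
  · refine Fin.lastCases (fun _ h' => absurd h'.2 (lt_irrefl _)) (fun l hl h' => ?_) l
    rw [castSucc_mem_part_addLast, (hB i).2 hi] at hl
    exact absurd (h l hl) (not_le.2 (by simpa using h'.1))

theorem last_notMem_arcs (Q : SetPartition (n + 1)) (j : Fin (n + 1)) :
    (Fin.last n, j) ∉ arcs Q := fun h => absurd ((mem_arcs Q).1 h).1 (not_lt.2 (Fin.le_last j))

theorem arcs_addLast_empty (P : SetPartition n) : arcs (addLast P ∅) = (arcs P).map (arcEmb n) := by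
  ext ⟨i, j⟩
  refine Fin.lastCases ?_ (fun i => ?_) i
  · simp [last_notMem_arcs]
  · refine Fin.lastCases ?_ (fun j => ?_) j
    · simp [(isBlockOrEmpty_empty P).mem_arcs_last]
    · simp [castSucc_mem_arcs_addLast]

theorem arcs_addLast_part (P : SetPartition n) {k : Fin n} (hk : ∀ j ∈ P.part k, j ≤ k) :
    arcs (addLast P (P.part k)) =
      insert (k.castSucc, Fin.last n) ((arcs P).map (arcEmb n)) := by
  ext ⟨i, j⟩
  refine Fin.lastCases ?_ (fun i => ?_) i
  · have h : Fin.last n ≠ k.castSucc := (Fin.castSucc_ne_last k).symm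
    simp [last_notMem_arcs, h]
  · refine Fin.lastCases ?_ (fun j => ?_) j
    · rw [(isBlockOrEmpty_part P k).mem_arcs_last]
      simp only [Finset.mem_insert, Finset.mem_map, arcEmb_apply, Prod.mk.injEq,
        Fin.castSucc_inj, and_true, Fin.castSucc_ne_last, and_false, exists_false,
        or_false]
      exact ⟨fun h => le_antisymm (hk i h.1) (h.2 k (mem_part_refl P k)),
        fun h => by subst h; exact ⟨mem_part_refl P i, hk⟩⟩
    · simp [castSucc_mem_arcs_addLast]

/-! ### Partitions compatible with a word -/

/-- The conditions that a word imposes on the underlying set partition. -/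
def Fits (ε : Fin n → Letter) (P : SetPartition n) : Prop :=
  ∀ i, (ε i = Letter.star ↔ ∀ j ∈ P.part i, i ≤ j) ∧
    (ε i = Letter.one → ∀ j ∈ P.part i, j ≤ i)

open Classical in
/-- The set partitions that fit a word. -/
def fitting (ε : Fin n → Letter) : Finset (SetPartition n) := {P | Fits ε P}

theorem mem_fitting {ε : Fin n → Letter} {P : SetPartition n} : P ∈ fitting ε ↔ Fits ε P := by
  simp [fitting]

open Classical in
/-- The largest elements of blocks that do not carry the letter `1`. -/
def openTops (ε : Fin n → Letter) (P : SetPartition n) : Finset (Fin n) :=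
  {i | (∀ j ∈ P.part i, j ≤ i) ∧ ε i ≠ Letter.one}

open Classical in
/-- The positions of the letter `1`. -/
def ones (ε : Fin n → Letter) : Finset (Fin n) := {i | ε i = Letter.one}

theorem mem_openTops {ε : Fin n → Letter} {P : SetPartition n} {i : Fin n} :
    i ∈ openTops ε P ↔ (∀ j ∈ P.part i, j ≤ i) ∧ ε i ≠ Letter.one := by
  simp [openTops]

theorem mem_ones {ε : Fin n → Letter} {i : Fin n} : i ∈ ones ε ↔ ε i = Letter.one := by
  simp [ones]

theorem top_unique {P : SetPartition n} {i k : Fin n} (hi : ∀ j ∈ P.part i, j ≤ i)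
    (hk : ∀ j ∈ P.part k, j ≤ k) (h : i ∈ P.part k) : i = k := by
  refine le_antisymm (hk i h) (hi k ?_)
  rw [(mem_part_iff P).1 h]; exact mem_part_refl P k

variable {ε : Fin (n + 1) → Letter}

/-- Removing the largest point changes no minimum among the remaining points, and an old point that
was a block maximum remains one. -/
theorem Fits.dropLast {P : SetPartition (n + 1)} (h : Fits ε P) :
    Fits (fun i => ε i.castSucc) (dropLast P) := by
  intro i
  refine ⟨(h i.castSucc).1.trans ⟨fun h' j hj => ?_, fun h' j => ?_⟩, fun h1 j hj => ?_⟩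
  · simpa using h' _ ((mem_part_dropLast P).1 hj)
  · refine Fin.lastCases (fun _ => Fin.le_last _) (fun j hj => ?_) j
    simpa using h' j ((mem_part_dropLast P).2 hj)
  · simpa using (h i.castSucc).2 h1 _ ((mem_part_dropLast P).1 hj)

/-- The last point is a block minimum only if it joins nothing, and `hone` ensures that it does not
displace a maximum carrying `1`. -/
theorem Fits.addLast (h : Fits (fun i => ε i.castSucc) P) (hB : IsBlockOrEmpty P B)
    (hlast : ε (Fin.last n) = Letter.star ↔ B = ∅)
    (hone : ∀ i, ε i.castSucc = Letter.one → i ∉ B) : Fits ε (addLast P B) := by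
  intro i
  refine Fin.lastCases ⟨hlast.trans ⟨?_, fun h' => ?_⟩, fun _ j _ => Fin.le_last j⟩
    (fun i => ⟨(h i).1.trans ⟨fun h' j => ?_, fun h' j hj => ?_⟩, fun h1 j => ?_⟩) i
  · rintro rfl j
    rw [hB.part_last]
    simp +contextual
  · refine Finset.eq_empty_of_forall_notMem fun j hj => ?_
    exact absurd (h' _ (hB.castSucc_mem.2 hj)) (not_le.2 (Fin.castSucc_lt_last j))
  · refine Fin.lastCases (fun _ => Fin.le_last _) (fun j hj => ?_) j
    simpa using h' j ((castSucc_mem_part_addLast P B).1 hj)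
  · simpa using h' _ ((castSucc_mem_part_addLast P B).2 hj)
  · refine Fin.lastCases (fun hj => ?_) (fun j hj => ?_) j
    · exact absurd (hB.last_mem.1 hj) (hone i h1)
    · simpa using (h i).2 h1 j ((castSucc_mem_part_addLast P B).1 hj)

/-- In a fitting partition a letter `1` sits at a block maximum. In the block of `k` that maximum is
`k`, which does not carry `1`. -/
theorem Fits.ne_one_of_mem (h : Fits (fun i => ε i.castSucc) P) {k : Fin n}
    (hk : k ∈ openTops (fun i => ε i.castSucc) P) {i : Fin n} (hi : ε i.castSucc = Letter.one) :
    i ∉ P.part k := fun hik => by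
  obtain ⟨hk, hk1⟩ := mem_openTops.1 hk
  exact hk1 (top_unique ((h i).2 hi) hk hik ▸ hi)

theorem addLast_dropLast {Q : SetPartition (n + 1)}
    (hB : IsBlockOrEmpty (dropLast Q) B) (h : ∀ i, i ∈ B ↔ i.castSucc ∈ Q.part (Fin.last n)) :
    addLast (dropLast Q) B = Q := by
  refine setPartition_ext fun i j => ?_
  refine Fin.lastCases ?_ (fun i => ?_) i <;> refine Fin.lastCases ?_ (fun j => ?_) j
  · simp
  · rw [hB.castSucc_mem, h]
  · rw [hB.last_mem, h, mem_part_iff, mem_part_iff, eq_comm]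
  · rw [castSucc_mem_part_addLast, mem_part_dropLast]

/-- A last point that is the minimum of its block is a singleton, so deleting it loses nothing. -/
theorem sum_fitting_star {M : Type*} [AddCommMonoid M] (hε : ε (Fin.last n) = Letter.star)
    (G : SetPartition (n + 1) → M) :
    ∑ P ∈ fitting ε, G P = ∑ P ∈ fitting fun i => ε i.castSucc, G (addLast P ∅) := by
  refine Finset.sum_bij' (fun P _ => dropLast P) (fun P _ => addLast P ∅) ?_ ?_ ?_ ?_ ?_
  · exact fun P hP => mem_fitting.2 (mem_fitting.1 hP).dropLast
  · exact fun P hP => mem_fitting.2 ((mem_fitting.1 hP).addLast (isBlockOrEmpty_empty P)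
      (by simp [hε]) (by simp))
  · intro Q hQ
    refine addLast_dropLast (isBlockOrEmpty_empty _) fun i => ?_
    simp only [Finset.notMem_empty, false_iff]
    exact fun h => absurd (((mem_fitting.1 hQ _).1.1 hε) _ h) (not_le.2 (Fin.castSucc_lt_last i))
  · exact fun P _ => dropLast_addLast P ∅
  · intro Q hQ
    congr 1
    refine (addLast_dropLast (isBlockOrEmpty_empty _) fun i => ?_).symm
    simp only [Finset.notMem_empty, false_iff]
    exact fun h => absurd (((mem_fitting.1 hQ _).1.1 hε) _ h) (not_le.2 (Fin.castSucc_lt_last i))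

/-- The last point is not the minimum of its block, so the block has a largest old point `k`. It
cannot carry `1`, being no maximum in the full partition; hence it is an open end after deletion. -/
theorem sum_fitting_join {M : Type*} [AddCommMonoid M] (hε : ε (Fin.last n) ≠ Letter.star)
    (G : SetPartition (n + 1) → M) :
    ∑ P ∈ fitting ε, G P = ∑ P ∈ fitting fun i => ε i.castSucc,
      ∑ k ∈ openTops (fun i => ε i.castSucc) P, G (addLast P (P.part k)) := by
  rw [Finset.sum_sigma']
  symm
  refine Finset.sum_bij (fun p _ => addLast p.1 (p.1.part p.2)) ?_ ?_ ?_ fun _ _ => rfl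
  · rintro ⟨P, k⟩ hp
    obtain ⟨hP, hk⟩ := Finset.mem_sigma.1 hp
    rw [mem_fitting] at hP ⊢
    refine hP.addLast (isBlockOrEmpty_part P k) ?_ fun i hi => hP.ne_one_of_mem hk hi
    simp only [hε, false_iff]
    exact Finset.ne_empty_of_mem (mem_part_refl P k)
  · rintro ⟨P, k⟩ hp ⟨Q, l⟩ hq h
    obtain ⟨-, hk⟩ := Finset.mem_sigma.1 hp
    obtain ⟨-, hl⟩ := Finset.mem_sigma.1 hq
    obtain rfl : P = Q := by
      simpa only [dropLast_addLast] using congrArg dropLast h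
    -- The old points in the block of the last point recover the block of `k`, and a block has only
    -- one maximum.
    have hkl : k ∈ P.part l := by
      rw [← (isBlockOrEmpty_part P l).castSucc_mem]
      simp only at h
      rw [← h, (isBlockOrEmpty_part P k).castSucc_mem]
      exact mem_part_refl P k
    obtain rfl := top_unique (mem_openTops.1 hk).1 (mem_openTops.1 hl).1 hkl
    rfl
  · intro Q hQ
    rw [mem_fitting] at hQ
    have hne : (Finset.univ.filter fun i : Fin n =>
        i.castSucc ∈ Q.part (Fin.last n)).Nonempty := by
      by_contra hemp
      rw [Finset.not_nonempty_iff_eq_empty] at hemp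
      refine hε ((hQ _).1.2 fun j => Fin.lastCases (fun _ => le_rfl) (fun j hj => ?_) j)
      have : j ∈ (∅ : Finset (Fin n)) := hemp ▸ by simpa using hj
      simp at this
    -- This is the starting point of the arc that ends at the last point.
    set k := Finset.max' _ hne with hk
    have hkmem : k.castSucc ∈ Q.part (Fin.last n) := by
      simpa using Finset.max'_mem _ hne
    have hpart := (mem_part_iff Q).1 hkmem
    have hmem : ∀ i, i ∈ (dropLast Q).part k ↔ i.castSucc ∈ Q.part (Fin.last n) := fun i => by
      rw [mem_part_dropLast, hpart]
    refine ⟨⟨dropLast Q, k⟩, Finset.mem_sigma.2 ⟨mem_fitting.2 hQ.dropLast, mem_openTops.2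
      ⟨fun j hj => Finset.le_max' _ j (by simpa using (hmem j).1 hj), fun h1 => ?_⟩⟩,
      addLast_dropLast (isBlockOrEmpty_part _ k) hmem⟩
    have := (hQ k.castSucc).2 h1 (Fin.last n) (by rw [hpart]; exact mem_part_refl Q _)
    exact absurd this (not_le.2 (Fin.castSucc_lt_last k))

theorem castSucc_mem_openTops_addLast (hB : IsBlockOrEmpty P B) {i : Fin n} :
    i.castSucc ∈ openTops ε (addLast P B) ↔
      i ∈ openTops (fun i => ε i.castSucc) P ∧ i ∉ B := by
  rw [mem_openTops, mem_openTops, and_right_comm]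
  refine and_congr_left fun _ => ⟨fun h => ⟨fun j hj => ?_, fun hi => ?_⟩, fun h j => ?_⟩
  · simpa using h _ ((castSucc_mem_part_addLast P B).2 hj)
  · exact absurd (h _ (hB.last_mem.2 hi)) (not_le.2 (Fin.castSucc_lt_last i))
  · refine Fin.lastCases (fun hj => absurd (hB.last_mem.1 hj) h.2) (fun j hj => ?_) j
    simpa using h.1 j ((castSucc_mem_part_addLast P B).1 hj)

theorem openTops_addLast_of_one (hB : IsBlockOrEmpty P B) (hε : ε (Fin.last n) = Letter.one) :
    openTops ε (addLast P B) =
      ((openTops (fun i => ε i.castSucc) P).filter (· ∉ B)).map Fin.castSuccEmb := by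
  ext i
  refine Fin.lastCases ?_ (fun i => ?_) i
  · simp [mem_openTops, hε]
  · simp [castSucc_mem_openTops_addLast hB]

theorem openTops_addLast_of_ne_one (hB : IsBlockOrEmpty P B)
    (hε : ε (Fin.last n) ≠ Letter.one) :
    openTops ε (addLast P B) = insert (Fin.last n)
      (((openTops (fun i => ε i.castSucc) P).filter (· ∉ B)).map Fin.castSuccEmb) := by
  ext i
  refine Fin.lastCases ?_ (fun i => ?_) i
  · simp [mem_openTops, hε, Fin.le_last]
  · simp [castSucc_mem_openTops_addLast hB]

/-- The block of `k` contains no other block maximum. -/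
theorem openTops_filter_part {ε : Fin n → Letter} {k : Fin n} (hk : k ∈ openTops ε P) :
    (openTops ε P).filter (· ∉ P.part k) = (openTops ε P).erase k := by
  ext i
  rw [Finset.mem_filter, Finset.mem_erase, and_comm]
  refine and_congr_left fun hi => not_congr ⟨fun h => ?_, fun h => h ▸ mem_part_refl P i⟩
  exact top_unique (mem_openTops.1 hi).1 (mem_openTops.1 hk).1 h

theorem ones_of_one (hε : ε (Fin.last n) = Letter.one) :
    ones ε = insert (Fin.last n) ((ones fun i => ε i.castSucc).map Fin.castSuccEmb) := by
  ext i
  refine Fin.lastCases ?_ (fun i => ?_) i <;> simp [mem_ones, hε]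

theorem ones_of_ne_one (hε : ε (Fin.last n) ≠ Letter.one) :
    ones ε = (ones fun i => ε i.castSucc).map Fin.castSuccEmb := by
  ext i
  refine Fin.lastCases ?_ (fun i => ?_) i <;> simp [mem_ones, hε]

end SetPartition

/-! ### The exponent of `q` -/

section Exponent

variable {n : ℕ}

/-- The exponent of `q`, for the arcs `E`, the negative arcs `N` and the open ends `O`. -/
def qExp (E N : Finset (Fin n × Fin n)) (O : Finset (Fin n)) : ℕ :=
  Finset.card {p ∈ E ×ˢ E | p.1.1 < p.2.1 ∧ p.2.1 < p.1.2 ∧ p.1.2 < p.2.2} +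
  Finset.card {p ∈ O ×ˢ E | p.2.1 < p.1 ∧ p.1 < p.2.2} +
  2 * Finset.card {p ∈ E ×ˢ N | p.1.1 < p.2.1 ∧ p.2.2 < p.1.2} +
  2 * Finset.card {p ∈ O ×ˢ N | p.1 < p.2.1 ∧ p.1 < p.2.2}

theorem card_filter_product {β γ : Type*} (s : Finset β) (t : Finset γ) (p : β × γ → Prop)
    [DecidablePred p] :
    Finset.card {x ∈ s ×ˢ t | p x} = ∑ a ∈ s, ∑ b ∈ t, if p (a, b) then 1 else 0 := by
  rw [Finset.card_filter, Finset.sum_product]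

/-- Written as sums of indicators, the exponent is additive in each set, so an inserted arc splits
off its own interactions. -/
theorem qExp_eq_sum (E N : Finset (Fin n × Fin n)) (O : Finset (Fin n)) :
    qExp E N O =
      (∑ a ∈ E, ∑ b ∈ E, if a.1 < b.1 ∧ b.1 < a.2 ∧ a.2 < b.2 then 1 else 0) +
      (∑ v ∈ O, ∑ a ∈ E, if a.1 < v ∧ v < a.2 then 1 else 0) +
      2 * (∑ a ∈ E, ∑ b ∈ N, if a.1 < b.1 ∧ b.2 < a.2 then 1 else 0) +
      2 * (∑ v ∈ O, ∑ b ∈ N, if v < b.1 ∧ v < b.2 then 1 else 0) := by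
  simp only [qExp, card_filter_product]

theorem qExp_map (E N : Finset (Fin n × Fin n)) (O : Finset (Fin n)) :
    qExp (E.map (arcEmb n)) (N.map (arcEmb n)) (O.map Fin.castSuccEmb) = qExp E N O := by
  simp only [qExp_eq_sum, Finset.sum_map, arcEmb_apply, Fin.castSuccEmb_apply,
    Fin.castSucc_lt_castSucc_iff]

/-- No arc covers the last point and none starts to its right, so as an open end it adds nothing to
MaxC or MaxL. -/
theorem qExp_insert_last (E N : Finset (Fin (n + 1) × Fin (n + 1))) (O : Finset (Fin n)) :
    qExp E N (insert (Fin.last n) (O.map Fin.castSuccEmb)) =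
      qExp E N (O.map Fin.castSuccEmb) := by
  have h : Fin.last n ∉ O.map Fin.castSuccEmb := by simp
  rw [qExp_eq_sum, qExp_eq_sum, Finset.sum_insert h, Finset.sum_insert h]
  simp [not_lt.2 (Fin.le_last _)]

theorem arcEmb_new_notMem (E : Finset (Fin n × Fin n)) (k : Fin n) :
    (k.castSucc, Fin.last n) ∉ E.map (arcEmb n) := by simp

variable {E N : Finset (Fin n × Fin n)} {O : Finset (Fin n)} {k : Fin n}

/-- Closing an open end by a positive arc. -/
theorem qExp_insert_pos (hN : ∀ a ∈ N, a.1 < a.2) (hk : k ∈ O) :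
    qExp (insert (k.castSucc, Fin.last n) (E.map (arcEmb n))) (N.map (arcEmb n))
        ((O.erase k).map Fin.castSuccEmb) =
      qExp E N O + (O.filter (k < ·)).card := by
  have h := arcEmb_new_notMem E k
  have hO : (O.filter (k < ·)).card = ∑ v ∈ O.erase k, if k < v then 1 else 0 := by
    rw [Finset.card_filter, ← Finset.add_sum_erase O _ hk]; simp
  -- Dropping the redundant inequality makes the MaxL terms of `k` literally equal to the nestings
  -- inside the new arc.
  have hD : (∑ b ∈ N, if k < b.1 ∧ k < b.2 then 1 else 0) =
      ∑ b ∈ N, if k < b.1 then 1 else 0 :=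
    Finset.sum_congr rfl fun b hb => by
      have := hN b hb
      congr 1
      exact propext ⟨fun h => h.1, fun h => ⟨h, h.trans this⟩⟩
  -- The MaxC terms of `k` reappear as crossings with the new arc and its MaxL terms as nestings
  -- inside it; only the open ends covered by the new arc are extra.
  simp only [qExp_eq_sum, hO, ← Finset.add_sum_erase O _ hk, Finset.sum_insert h,
    Finset.sum_map, arcEmb_apply, Fin.castSuccEmb_apply, Fin.castSucc_lt_castSucc_iff, hD,
    Fin.castSucc_lt_last, not_lt.2 (Fin.le_last _), and_true, and_false, lt_irrefl,
    if_false, Finset.sum_add_distrib, Finset.sum_const_zero]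
  ring

/-- Closing an open end by a negative arc. -/
theorem qExp_insert_neg (hN : ∀ a ∈ N, a.1 < a.2) (hk : k ∈ O) :
    qExp (insert (k.castSucc, Fin.last n) (E.map (arcEmb n)))
        (insert (k.castSucc, Fin.last n) (N.map (arcEmb n)))
        ((O.erase k).map Fin.castSuccEmb) =
      qExp E N O + (O.filter (k < ·)).card + 2 * (O.filter (· < k)).card := by
  have h := arcEmb_new_notMem E k
  have hO : (O.filter (· < k)).card = ∑ v ∈ O.erase k, if v < k then 1 else 0 := by
    rw [Finset.card_filter, ← Finset.add_sum_erase O _ hk]; simp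
  -- Compared with a positive arc, negativity adds only MaxL pairs with the open ends left of `k`:
  -- no arc ends beyond the last point, so none nests the new one.
  rw [← qExp_insert_pos hN hk, qExp_eq_sum, qExp_eq_sum, hO]
  simp only [Finset.sum_insert (arcEmb_new_notMem N k), Finset.sum_insert h,
    Finset.sum_map, arcEmb_apply, Fin.castSuccEmb_apply, Fin.castSucc_lt_castSucc_iff,
    Fin.castSucc_lt_last, not_lt.2 (Fin.le_last _), and_true, and_false, lt_irrefl,
    if_false, Finset.sum_add_distrib, Finset.sum_const_zero]
  ring

end Exponent

/-! ### The vectors carried by the blocks -/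

section Vectors

variable {n : ℕ}

/-- The colour operator of the arc `(i, j)`, for the set `N` of negative arcs. -/
def arcOp (bar : H →L[ℂ] H) (N : Finset (Fin n × Fin n)) (i j : Fin n) : H →L[ℂ] H :=
  if (i, j) ∈ N then bar else ContinuousLinearMap.id ℂ H

/-- The operator `ExtPartition.hatT`, for the set `N` of negative arcs. -/
def chainOp (bar : H →L[ℂ] H) (A : Fin n → H →L[ℂ] H) (N : Finset (Fin n × Fin n)) :
    List (Fin n) → H →L[ℂ] H
  | j :: i :: l => A j ∘L arcOp bar N i j ∘L chainOp bar A N (i :: l)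
  | _ => ContinuousLinearMap.id ℂ H

/-- The operator `ExtPartition.T`, for the set `N` of negative arcs. -/
def innerChainOp (bar : H →L[ℂ] H) (A : Fin n → H →L[ℂ] H) (N : Finset (Fin n × Fin n)) :
    List (Fin n) → H →L[ℂ] H
  | j :: i :: l => arcOp bar N i j ∘L chainOp bar A N (i :: l)
  | _ => ContinuousLinearMap.id ℂ H

theorem hatT_eq_chainOp (bar : H →L[ℂ] H) (A : Fin n → H →L[ℂ] H) (π : ExtPartition n)
    (l : List (Fin n)) : π.hatT bar A l = chainOp bar A π.negArcs l := by
  induction l with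
  | nil => rfl
  | cons j l ih =>
    cases l with
    | nil => rfl
    | cons i l => rw [ExtPartition.hatT, chainOp, ih]; rfl

theorem T_eq_innerChainOp (bar : H →L[ℂ] H) (A : Fin n → H →L[ℂ] H) (π : ExtPartition n)
    (l : List (Fin n)) : π.T bar A l = innerChainOp bar A π.negArcs l := by
  rcases l with _ | ⟨j, _ | ⟨i, l⟩⟩
  · rfl
  · rfl
  · rw [ExtPartition.T, innerChainOp, hatT_eq_chainOp]; rfl

/-- The elements of the block of `i`, from the largest to the smallest. -/
def descList (P : SetPartition n) (i : Fin n) : List (Fin n) :=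
  (P.part i).sort (fun a b => b ≤ a)

/-- The least element of the block of `i`. -/
def leastElt (P : SetPartition n) (i : Fin n) : Fin n :=
  (P.part i).min' ⟨i, mem_part_refl P i⟩

/-- The vector `T̂_B x_{min B}` for the block `B` of `i`. -/
def blockVec (bar : H →L[ℂ] H) (x : Fin n → H) (A : Fin n → H →L[ℂ] H) (P : SetPartition n)
    (N : Finset (Fin n × Fin n)) (i : Fin n) : H :=
  chainOp bar A N (descList P i) (x (leastElt P i))

/-- The scalar `⟨x_{max B}, T_B x_{min B}⟩` for the block `B` with largest element `i`. -/
def blockScalar (bar : H →L[ℂ] H) (x : Fin n → H) (A : Fin n → H →L[ℂ] H) (P : SetPartition n)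
    (N : Finset (Fin n × Fin n)) (i : Fin n) : ℂ :=
  inner ℂ (x i) (innerChainOp bar A N (descList P i) (x (leastElt P i)))

variable {N : Finset (Fin n × Fin n)} {N' : Finset (Fin (n + 1) × Fin (n + 1))}
  {P : SetPartition n} {B : Finset (Fin n)}
  (bar : H →L[ℂ] H) (x : Fin (n + 1) → H) (A : Fin (n + 1) → H →L[ℂ] H)

/-- The assumption `hN` constrains only the old arcs in `N'`, so it covers both colours of the new
arc. -/
theorem arcOp_castSucc (hN : ∀ a, arcEmb n a ∈ N' ↔ a ∈ N) (i j : Fin n) :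
    arcOp bar N' i.castSucc j.castSucc = arcOp bar N i j := by
  have h := hN (i, j)
  rw [arcEmb_apply] at h
  simp only [arcOp, h]

theorem chainOp_map_castSucc (hN : ∀ a, arcEmb n a ∈ N' ↔ a ∈ N) (l : List (Fin n)) :
    chainOp bar A N' (l.map Fin.castSucc) = chainOp bar (fun i => A i.castSucc) N l := by
  induction l with
  | nil => rfl
  | cons j l ih =>
    cases l with
    | nil => rfl
    | cons i l =>
      rw [chainOp, ← ih]
      simp only [List.map_cons, chainOp, arcOp_castSucc bar hN]

theorem innerChainOp_map_castSucc (hN : ∀ a, arcEmb n a ∈ N' ↔ a ∈ N) (l : List (Fin n)) :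
    innerChainOp bar A N' (l.map Fin.castSucc) =
      innerChainOp bar (fun i => A i.castSucc) N l := by
  rcases l with _ | ⟨j, _ | ⟨i, l⟩⟩
  · rfl
  · rfl
  · have := chainOp_map_castSucc bar A hN (i :: l)
    rw [List.map_cons] at this
    simp only [List.map_cons, innerChainOp, arcOp_castSucc bar hN, this]

theorem sort_map_castSucc (S : Finset (Fin n)) :
    (S.map Fin.castSuccEmb).sort (fun a b => b ≤ a) =
      (S.sort (fun a b => b ≤ a)).map Fin.castSucc :=
  (Finset.map_sort Fin.castSuccEmb S (fun a b => b ≤ a) (fun a b => b ≤ a) (by simp)).symm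

theorem descList_castSucc (hB : IsBlockOrEmpty P B) {i : Fin n} (hi : i ∉ B) :
    descList (addLast P B) i.castSucc = (descList P i).map Fin.castSucc := by
  rw [descList, hB.part_castSucc hi, sort_map_castSucc, descList]

theorem eq_leastElt (P : SetPartition n) {i j : Fin n} (hj : j ∈ P.part i)
    (h : ∀ l ∈ P.part i, j ≤ l) : leastElt P i = j :=
  le_antisymm (Finset.min'_le _ _ hj) (Finset.le_min' _ _ _ h)

theorem leastElt_mem (P : SetPartition n) (i : Fin n) : leastElt P i ∈ P.part i :=
  Finset.min'_mem _ _

theorem leastElt_le (P : SetPartition n) {i j : Fin n} (hj : j ∈ P.part i) : leastElt P i ≤ j :=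
  Finset.min'_le _ _ hj

theorem leastElt_castSucc (P : SetPartition n) (B : Finset (Fin n)) (i : Fin n) :
    leastElt (addLast P B) i.castSucc = (leastElt P i).castSucc := by
  refine eq_leastElt _ ((castSucc_mem_part_addLast P B).2 (leastElt_mem P i)) fun l => ?_
  refine Fin.lastCases (fun _ => Fin.le_last _) (fun l hl => ?_) l
  simpa using leastElt_le P ((castSucc_mem_part_addLast P B).1 hl)

theorem blockVec_castSucc (hN : ∀ a, arcEmb n a ∈ N' ↔ a ∈ N) (hB : IsBlockOrEmpty P B)
    {i : Fin n} (hi : i ∉ B) :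
    blockVec bar x A (addLast P B) N' i.castSucc =
      blockVec bar (fun i => x i.castSucc) (fun i => A i.castSucc) P N i := by
  rw [blockVec, descList_castSucc hB hi, leastElt_castSucc, chainOp_map_castSucc bar A hN, blockVec]

theorem blockScalar_castSucc (hN : ∀ a, arcEmb n a ∈ N' ↔ a ∈ N) (hB : IsBlockOrEmpty P B)
    {i : Fin n} (hi : i ∉ B) :
    blockScalar bar x A (addLast P B) N' i.castSucc =
      blockScalar bar (fun i => x i.castSucc) (fun i => A i.castSucc) P N i := by
  rw [blockScalar, descList_castSucc hB hi, leastElt_castSucc, innerChainOp_map_castSucc bar A hN,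
    blockScalar]

theorem blockVec_last_empty (P : SetPartition n) (N' : Finset (Fin (n + 1) × Fin (n + 1))) :
    blockVec bar x A (addLast P ∅) N' (Fin.last n) = x (Fin.last n) := by
  have h := (isBlockOrEmpty_empty P).part_last
  rw [blockVec, descList, eq_leastElt _ (mem_part_refl _ _) (by simp [h]), h]
  simp [chainOp]

/-- `chainOp` unfolds only when the first two entries are visible, so `k` has to be exposed behind
the new point. -/
theorem descList_last (P : SetPartition n) {k : Fin n} (hk : ∀ j ∈ P.part k, j ≤ k) :
    ∃ l : List (Fin n), descList P k = k :: l ∧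
      descList (addLast P (P.part k)) (Fin.last n) =
        Fin.last n :: k.castSucc :: l.map Fin.castSucc := by
  refine ⟨((P.part k).erase k).sort (fun a b => b ≤ a), ?_⟩
  have h : descList P k = k :: ((P.part k).erase k).sort (fun a b => b ≤ a) := by
    conv_lhs => rw [descList, ← Finset.insert_erase (mem_part_refl P k)]
    exact Finset.sort_insert _ (fun b hb => hk b (Finset.mem_of_mem_erase hb)) (by simp)
  refine ⟨h, ?_⟩
  rw [descList, (isBlockOrEmpty_part P k).part_last,
    Finset.sort_insert _ (fun b _ => Fin.le_last b) (by simp), sort_map_castSucc]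
  rw [descList] at h
  rw [h, List.map_cons]

theorem leastElt_last (P : SetPartition n) (k : Fin n) :
    leastElt (addLast P (P.part k)) (Fin.last n) = (leastElt P k).castSucc := by
  have hB := isBlockOrEmpty_part P k
  refine eq_leastElt _ (hB.castSucc_mem.2 (leastElt_mem P k)) fun l => ?_
  refine Fin.lastCases (fun _ => Fin.le_last _) (fun l hl => ?_) l
  simpa using leastElt_le P (hB.castSucc_mem.1 hl)

theorem blockVec_last_part (hN : ∀ a, arcEmb n a ∈ N' ↔ a ∈ N) {k : Fin n}
    (hk : ∀ j ∈ P.part k, j ≤ k) :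
    blockVec bar x A (addLast P (P.part k)) N' (Fin.last n) =
      A (Fin.last n) (arcOp bar N' k.castSucc (Fin.last n)
        (blockVec bar (fun i => x i.castSucc) (fun i => A i.castSucc) P N k)) := by
  obtain ⟨l, h1, h2⟩ := descList_last P hk
  rw [blockVec, h2, leastElt_last, chainOp, blockVec, h1, ← chainOp_map_castSucc bar A hN]
  rfl

/-- `innerChainOp` omits the operator of the block maximum. What remains is the vector of the
shortened block followed by the colour of the new arc, which is what annihilation pairs with `x
(Fin.last n)`. -/
theorem blockScalar_last_part (hN : ∀ a, arcEmb n a ∈ N' ↔ a ∈ N) {k : Fin n}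
    (hk : ∀ j ∈ P.part k, j ≤ k) :
    blockScalar bar x A (addLast P (P.part k)) N' (Fin.last n) =
      inner ℂ (x (Fin.last n)) (arcOp bar N' k.castSucc (Fin.last n)
        (blockVec bar (fun i => x i.castSucc) (fun i => A i.castSucc) P N k)) := by
  obtain ⟨l, h1, h2⟩ := descList_last P hk
  rw [blockScalar, h2, leastElt_last, innerChainOp, blockVec, h1, ← chainOp_map_castSucc bar A hN]
  rfl

end Vectors

/-! ### Extended partitions as partitions with negative arcs -/

section Words

variable {n : ℕ}

open Classical in
/-- The extended partition with given negative arcs whose marked blocks are the blocks of size at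
least two without a letter `1`. -/
def extOf (ε : Fin n → Letter) (P : SetPartition n) (N : Finset (Fin n × Fin n)) :
    ExtPartition n where
  part := P
  -- The intersection makes the definition total in `N`; it changes nothing when `N ⊆ arcs P`.
  negArcs := N ∩ arcs P
  marked := {B ∈ P.parts | 2 ≤ B.card ∧ ∀ i ∈ B, ε i ≠ Letter.one}
  negArcs_subset := Finset.inter_subset_right
  marked_subset := fun B hB => by
    simp only [Finset.mem_filter] at hB ⊢
    exact ⟨hB.1, hB.2.1⟩

variable {ε : Fin n → Letter} {π : ExtPartition n}

theorem ExtPartition.Compatible.fits (h : π.Compatible ε) : Fits ε π.part := fun i =>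
  ⟨(h i).1, fun h1 => by
    have := (h i).2.1.1 h1
    simp only [ExtPartition.closedEnds, Finset.mem_filter] at this
    exact this.2.1⟩

theorem ExtPartition.Compatible.closedEnds_eq (h : π.Compatible ε) : π.closedEnds = ones ε := by
  ext i
  rw [mem_ones, (h i).2.1]

theorem card_part_pos (P : SetPartition n) (i : Fin n) : 1 ≤ (P.part i).card :=
  Finset.card_pos.2 ⟨i, mem_part_refl P i⟩

theorem ExtPartition.mem_closedEnds {i : Fin n} : i ∈ π.closedEnds ↔
    (∀ j ∈ π.part.part i, j ≤ i) ∧ π.part.part i ∉ π.marked ∧ 2 ≤ (π.part.part i).card := by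
  rw [ExtPartition.closedEnds, Finset.mem_filter, and_iff_right (Finset.mem_univ i)]
  rfl

/-- A block maximum is either an open or a closed end, and compatibility identifies the closed ends
with the letters `1`. -/
theorem ExtPartition.Compatible.openEnds_eq (h : π.Compatible ε) :
    π.openEnds = openTops ε π.part := by
  ext i
  have hc := card_part_pos π.part i
  rw [mem_openTops, Ne, (h i).2.1, ExtPartition.mem_closedEnds]
  rw [ExtPartition.openEnds, Finset.mem_filter, and_iff_right (Finset.mem_univ i)]
  refine and_congr_right fun ht => ?_
  have h1 : (π.blockOf i).card = 1 ↔ ¬ 2 ≤ (π.part.part i).card := by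
    rw [ExtPartition.blockOf]; omega
  rw [h1, ExtPartition.blockOf]
  tauto

/-- The marks can be recovered from the word: an unmarked block of size at least two has a closed
maximum, which carries `1`, while a marked block contains no closed end and thus no `1`. -/
theorem ExtPartition.Compatible.extOf_eq (h : π.Compatible ε) :
    extOf ε π.part π.negArcs = π := by
  refine ExtPartition.ext rfl (Finset.inter_eq_left.2 π.negArcs_subset) ?_
  ext B
  simp only [extOf, Finset.mem_filter]
  constructor
  · rintro ⟨hB, hc, h1⟩
    have hne := π.part.nonempty_of_mem_parts hB
    have hP : π.part.part (B.max' hne) = B := π.part.part_eq_of_mem hB (B.max'_mem hne)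
    have := h1 _ (B.max'_mem hne)
    rw [Ne, (h _).2.1, ExtPartition.mem_closedEnds, hP] at this
    by_contra hm
    exact this ⟨fun j hj => B.le_max' j hj, hm, hc⟩
  · intro hB
    obtain ⟨hP, hc⟩ := Finset.mem_filter.1 (π.marked_subset hB)
    refine ⟨hP, hc, fun i hi h1 => ?_⟩
    rw [(h _).2.1, ExtPartition.mem_closedEnds, π.part.part_eq_of_mem hP hi] at h1
    exact h1.2.1 hB

theorem Letter.eq_prime_iff {a : Letter} : a = .prime ↔ a ≠ .star ∧ a ≠ .one := by
  cases a <;> simp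

/-- A letter other than `∗` forces a smaller element, hence block size at least two. A letter `1`
can only sit at a block maximum, so `extOf` leaves unmarked, among blocks of that size, exactly
those whose maximum carries `1`. The clause for `′` follows by exclusion. -/
theorem Fits.compatible {P : SetPartition n} (h : Fits ε P) (N : Finset (Fin n × Fin n)) :
    (extOf ε P N).Compatible ε := by
  have hm : ∀ i, P.part i ∈ (extOf ε P N).marked ↔
      2 ≤ (P.part i).card ∧ ∀ j ∈ P.part i, ε j ≠ Letter.one := fun i => by
    simp only [extOf, Finset.mem_filter, and_iff_right_iff_imp]
    exact fun _ => P.part_mem.2 (Finset.mem_univ i)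
  have hlow : ∀ i, ε i ≠ Letter.star ↔ ∃ j ∈ P.part i, j < i := fun i => by
    rw [Ne, (h i).1]; push Not; rfl
  have hcard : ∀ i, ε i ≠ Letter.star → 2 ≤ (P.part i).card := fun i hi => by
    obtain ⟨j, hj, hlt⟩ := (hlow i).1 hi
    exact Finset.one_lt_card.2 ⟨j, hj, i, mem_part_refl P i, hlt.ne⟩
  have huniq : ∀ i j, (∀ l ∈ P.part i, l ≤ i) → j ∈ P.part i → ε j = Letter.one → j = i :=
    fun i j hi hj h1 => top_unique ((h j).2 h1) hi hj
  intro i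
  refine ⟨(h i).1, ?_, ?_⟩
  · rw [ExtPartition.mem_closedEnds]
    change _ ↔ _ ∧ P.part i ∉ _ ∧ _
    rw [hm]
    constructor
    · intro h1
      exact ⟨(h i).2 h1, fun h' => h'.2 i (mem_part_refl P i) h1, hcard i (by simp [h1])⟩
    · rintro ⟨ht, hnm, hc⟩
      push Not at hnm
      obtain ⟨j, hj, h1⟩ := hnm hc
      exact huniq i j ht hj h1 ▸ h1
  · change _ ↔ (∃ j ∈ P.part i, j < i) ∧ ((∃ j ∈ P.part i, i < j) ∨ P.part i ∈ _)
    rw [hm, Letter.eq_prime_iff, ← hlow]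
    refine and_congr_right fun hs => ⟨fun h1 => ?_, fun h' h1 => ?_⟩
    · by_cases ht : ∃ j ∈ P.part i, i < j
      · exact Or.inl ht
      · push Not at ht
        exact Or.inr ⟨hcard i hs, fun j hj hj1 => h1 (huniq i j ht hj hj1 ▸ hj1)⟩
    · rcases h' with ⟨j, hj, hlt⟩ | h'
      · exact absurd ((h i).2 h1 j hj) (not_le.2 hlt)
      · exact h'.2 i (mem_part_refl P i) h1

theorem sum_ofWord {M : Type*} [AddCommMonoid M] (ε : Fin n → Letter)
    (G : SetPartition n → Finset (Fin n × Fin n) → M) :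
    ∑ π ∈ ExtPartition.ofWord ε, G π.part π.negArcs =
      ∑ P ∈ fitting ε, ∑ N ∈ (arcs P).powerset, G P N := by
  rw [Finset.sum_sigma']
  refine Finset.sum_bij' (fun π _ => (⟨π.part, π.negArcs⟩ : Σ _ : SetPartition n, _))
    (fun p _ => extOf ε p.1 p.2) ?_ ?_ ?_ ?_ fun _ _ => rfl
  · intro π hπ
    exact Finset.mem_sigma.2 ⟨mem_fitting.2 (ExtPartition.Compatible.fits (by
      simpa [ExtPartition.ofWord] using hπ)), Finset.mem_powerset.2 π.negArcs_subset⟩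
  · rintro ⟨P, N⟩ hp
    simpa [ExtPartition.ofWord] using (mem_fitting.1 (Finset.mem_sigma.1 hp).1).compatible N
  · intro π hπ
    exact ExtPartition.Compatible.extOf_eq (by simpa [ExtPartition.ofWord] using hπ)
  · rintro ⟨P, N⟩ hp
    have : N ∩ arcs P = N :=
      Finset.inter_eq_left.2 (Finset.mem_powerset.1 (Finset.mem_sigma.1 hp).2)
    simp only [extOf, this]

end Words

/-! ### The summands -/

section Terms

variable {n : ℕ}

/-- The coefficient `α^Narc q^(⋯) R` of a partition. -/
def coeff (α q : ℝ) (bar : H →L[ℂ] H) (x : Fin n → H) (A : Fin n → H →L[ℂ] H)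
    (ε : Fin n → Letter) (P : SetPartition n) (N : Finset (Fin n × Fin n)) : ℂ :=
  (α : ℂ) ^ N.card * (q : ℂ) ^ qExp (arcs P) N (openTops ε P) *
    ∏ i ∈ ones ε, blockScalar bar x A P N i

/-- The tensor `R̂` of a partition. -/
def tensorPart (bar : H →L[ℂ] H) (x : Fin n → H) (A : Fin n → H →L[ℂ] H)
    (ε : Fin n → Letter) (P : SetPartition n) (N : Finset (Fin n × Fin n)) : Fock H :=
  tens (blockVec bar x A P N) (openTops ε P)

theorem sum_ofWord_eq (α q : ℝ) (bar : H →L[ℂ] H) (x : Fin n → H) (A : Fin n → H →L[ℂ] H)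
    (ε : Fin n → Letter) :
    ∑ π ∈ ExtPartition.ofWord ε,
        ((α : ℂ) ^ π.Narc * (q : ℂ) ^ (π.rc + π.MaxC + 2 * π.rnarc + 2 * π.MaxL) *
            π.R bar x A) • π.hatR bar x A =
      ∑ P ∈ fitting ε, ∑ N ∈ (arcs P).powerset,
        coeff α q bar x A ε P N • tensorPart bar x A ε P N := by
  rw [← sum_ofWord ε fun P N => coeff α q bar x A ε P N • tensorPart bar x A ε P N]
  refine Finset.sum_congr rfl fun π hπ => ?_
  have h : π.Compatible ε := by simpa [ExtPartition.ofWord] using hπ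
  have hR : π.R bar x A = ∏ i ∈ ones ε, blockScalar bar x A π.part π.negArcs i := by
    rw [ExtPartition.R, h.closedEnds_eq]
    refine Finset.prod_congr rfl fun i _ => ?_
    rw [T_eq_innerChainOp]; rfl
  have hT : π.hatR bar x A = tensorPart bar x A ε π.part π.negArcs := by
    rw [ExtPartition.hatR, h.openEnds_eq]
    simp only [hatT_eq_chainOp]; rfl
  rw [hR, hT, coeff, ← h.openEnds_eq]
  rfl

/-- The negative arcs on `Fin (n + 1)` after adding the arc `(k, n)` with a given colour. -/
def addArc (N : Finset (Fin n × Fin n)) (k : Fin n) (neg : Bool) :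
    Finset (Fin (n + 1) × Fin (n + 1)) :=
  if neg then insert (k.castSucc, Fin.last n) (N.map (arcEmb n)) else N.map (arcEmb n)

theorem sum_powerset_map {M : Type*} [AddCommMonoid M] (E : Finset (Fin n × Fin n))
    (G : Finset (Fin (n + 1) × Fin (n + 1)) → M) :
    ∑ N ∈ (E.map (arcEmb n)).powerset, G N = ∑ N ∈ E.powerset, G (N.map (arcEmb n)) := by
  symm
  refine Finset.sum_nbij (Finset.map (arcEmb n)) ?_ ?_ ?_ fun _ _ => rfl
  · exact fun N hN => Finset.mem_powerset.2 (Finset.map_subset_map.2 (Finset.mem_powerset.1 hN))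
  · exact (Finset.map_injective _).injOn
  · intro N hN
    obtain ⟨N', h, rfl⟩ := Finset.subset_map_iff.1 (Finset.mem_powerset.1 hN)
    exact ⟨N', by simpa using h, rfl⟩

theorem sum_powerset_addArc {M : Type*} [AddCommMonoid M] (E : Finset (Fin n × Fin n)) (k : Fin n)
    (G : Finset (Fin (n + 1) × Fin (n + 1)) → M) :
    ∑ N ∈ (insert (k.castSucc, Fin.last n) (E.map (arcEmb n))).powerset, G N =
      ∑ N ∈ E.powerset, ∑ neg : Bool, G (addArc N k neg) := by
  rw [Finset.sum_powerset_insert (arcEmb_new_notMem E k), sum_powerset_map,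
    sum_powerset_map E fun N => G (insert _ N), ← Finset.sum_add_distrib]
  simp [addArc, add_comm]

theorem arcEmb_mem_addArc (N : Finset (Fin n × Fin n)) (k : Fin n) (neg : Bool)
    (a : Fin n × Fin n) : arcEmb n a ∈ addArc N k neg ↔ a ∈ N := by
  cases neg
  · exact Finset.mem_map' _
  · rw [addArc, if_pos rfl, Finset.mem_insert, Finset.mem_map']
    simp

theorem arcOp_addArc (bar : H →L[ℂ] H) (N : Finset (Fin n × Fin n)) (k : Fin n) (neg : Bool) :
    arcOp bar (addArc N k neg) k.castSucc (Fin.last n) = newColor bar neg := by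
  cases neg <;> simp [arcOp, addArc, newColor]

/-- This matches the operator coefficient with the change of the statistics when the open end `k` is
used up by the new arc. -/
theorem newWeight_mul (α q : ℝ) {E N : Finset (Fin n × Fin n)} {O : Finset (Fin n)} {k : Fin n}
    (neg : Bool) (hN : ∀ a ∈ N, a.1 < a.2) (hk : k ∈ O) :
    (α : ℂ) ^ (addArc N k neg).card *
        (q : ℂ) ^ qExp (insert (k.castSucc, Fin.last n) (E.map (arcEmb n))) (addArc N k neg)
          ((O.erase k).map Fin.castSuccEmb) =
      newWeight α q neg (O.filter (k < ·)).card (O.filter (· < k)).card *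
        ((α : ℂ) ^ N.card * (q : ℂ) ^ qExp E N O) := by
  cases neg
  · simp only [addArc, newWeight, Bool.false_eq_true, if_false, qExp_insert_pos hN hk,
      Finset.card_map]
    ring
  · simp only [addArc, newWeight, if_true, qExp_insert_neg hN hk,
      Finset.card_insert_of_notMem (arcEmb_new_notMem N k), Finset.card_map]
    ring

theorem sort_insert_last (O : Finset (Fin n)) :
    (insert (Fin.last n) (O.map Fin.castSuccEmb)).sort (fun a b => a ≤ b) =
      (O.sort (fun a b => a ≤ b)).map Fin.castSucc ++ [Fin.last n] := by
  have hnd : ((O.sort (fun a b => a ≤ b)).map Fin.castSucc ++ [Fin.last n]).Nodup := by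
    rw [List.nodup_append]
    refine ⟨(Finset.sort_nodup _ _).map (Fin.castSucc_injective n), by simp, ?_⟩
    simp only [List.mem_map, List.mem_singleton]
    rintro _ ⟨i, _, rfl⟩ _ rfl
    exact Fin.castSucc_ne_last i
  have hs := (List.toFinset_sort (fun a b : Fin (n + 1) => a ≤ b) hnd).2 (by
    rw [List.pairwise_append]
    refine ⟨List.pairwise_map.2 ?_, by simp, by simp [Fin.le_last]⟩
    simp)
  rw [← hs]
  congr 1
  ext i
  simp

theorem tens_map_castSucc (v : Fin (n + 1) → H) (w : Fin n → H) (O : Finset (Fin n))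
    (h : ∀ i ∈ O, v i.castSucc = w i) :
    tens v (O.map Fin.castSuccEmb) = pureTensor ((O.sort (fun a b => a ≤ b)).map w) := by
  rw [tens, ← Finset.map_sort Fin.castSuccEmb O (fun a b => a ≤ b) (fun a b => a ≤ b) (by simp),
    List.map_map]
  congr 1
  exact List.map_congr_left fun i hi => h i (by simpa using hi)

theorem tens_insert_last (v : Fin (n + 1) → H) (w : Fin n → H) (O : Finset (Fin n))
    (h : ∀ i ∈ O, v i.castSucc = w i) :
    tens v (insert (Fin.last n) (O.map Fin.castSuccEmb)) =
      pureTensor ((O.sort (fun a b => a ≤ b)).map w ++ [v (Fin.last n)]) := by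
  rw [tens, sort_insert_last, List.map_append, List.map_map]
  congr 2
  exact List.map_congr_left fun i hi => h i (by simpa using hi)

variable (α q : ℝ) (bar : H →L[ℂ] H) (x : Fin (n + 1) → H) (A : Fin (n + 1) → H →L[ℂ] H)
  {ε : Fin (n + 1) → Letter} {P : SetPartition n} {N : Finset (Fin n × Fin n)}

theorem coeff_star (hε : ε (Fin.last n) = Letter.star) :
    coeff α q bar x A ε (addLast P ∅) (N.map (arcEmb n)) =
      coeff α q bar (fun i => x i.castSucc) (fun i => A i.castSucc)
        (fun i => ε i.castSucc) P N := by
  have hne : ε (Fin.last n) ≠ Letter.one := by simp [hε]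
  rw [coeff, arcs_addLast_empty, openTops_addLast_of_ne_one (isBlockOrEmpty_empty P) hne,
    qExp_insert_last, qExp_map, ones_of_ne_one hne, Finset.prod_map, Finset.card_map, coeff]
  simp only [Finset.notMem_empty, not_false_eq_true, Finset.filter_true]
  congr 1
  exact Finset.prod_congr rfl fun i _ => blockScalar_castSucc bar x A
    (fun a => Finset.mem_map' _) (isBlockOrEmpty_empty P) (Finset.notMem_empty i)

theorem tensorPart_star (hε : ε (Fin.last n) = Letter.star) :
    tensorPart bar x A ε (addLast P ∅) (N.map (arcEmb n)) =
      creation (x (Fin.last n)) (tensorPart bar (fun i => x i.castSucc) (fun i => A i.castSucc)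
        (fun i => ε i.castSucc) P N) := by
  have hne : ε (Fin.last n) ≠ Letter.one := by simp [hε]
  rw [tensorPart, openTops_addLast_of_ne_one (isBlockOrEmpty_empty P) hne, tens_insert_last _
    (blockVec bar (fun i => x i.castSucc) (fun i => A i.castSucc) P N), blockVec_last_empty,
    tensorPart, creation_tens]
  · simp
  · exact fun i _ => blockVec_castSucc bar x A (fun a => Finset.mem_map' _)
      (isBlockOrEmpty_empty P) (Finset.notMem_empty i)

variable {k : Fin n} (neg : Bool)

theorem notMem_part_of_mem_erase {ε : Fin n → Letter} (hk : k ∈ openTops ε P) {i : Fin n}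
    (hi : i ∈ (openTops ε P).erase k) : i ∉ P.part k := by
  rw [← openTops_filter_part hk] at hi
  exact (Finset.mem_filter.1 hi).2

theorem prod_ones_castSucc (hP : Fits (fun i => ε i.castSucc) P)
    (hk : k ∈ openTops (fun i => ε i.castSucc) P) :
    ∏ i ∈ (ones fun i => ε i.castSucc).map Fin.castSuccEmb,
        blockScalar bar x A (addLast P (P.part k)) (addArc N k neg) i =
      ∏ i ∈ ones fun i => ε i.castSucc,
        blockScalar bar (fun i => x i.castSucc) (fun i => A i.castSucc) P N i := by
  rw [Finset.prod_map]
  exact Finset.prod_congr rfl fun i hi => blockScalar_castSucc bar x A (arcEmb_mem_addArc N k neg)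
    (isBlockOrEmpty_part P k) (hP.ne_one_of_mem hk ((mem_ones (ε := fun i => ε i.castSucc)).1 hi))

/-- The letter `1` closes the block of `k`, whose scalar enters the product as one new factor; the
other blocks carrying `1` are untouched. -/
theorem coeff_one (hε : ε (Fin.last n) = Letter.one) (hP : Fits (fun i => ε i.castSucc) P)
    (hk : k ∈ openTops (fun i => ε i.castSucc) P) (hN : N ⊆ arcs P) :
    coeff α q bar x A ε (addLast P (P.part k)) (addArc N k neg) =
      coeff α q bar (fun i => x i.castSucc) (fun i => A i.castSucc)
        (fun i => ε i.castSucc) P N *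
      (newWeight α q neg ((openTops (fun i => ε i.castSucc) P).filter (k < ·)).card
        ((openTops (fun i => ε i.castSucc) P).filter (· < k)).card *
      inner ℂ (x (Fin.last n)) (newColor bar neg
        (blockVec bar (fun i => x i.castSucc) (fun i => A i.castSucc) P N k))) := by
  have hk' := (mem_openTops.1 hk).1
  have hB := isBlockOrEmpty_part P k
  rw [coeff, arcs_addLast_part P hk', openTops_addLast_of_one hB hε, openTops_filter_part hk,
    newWeight_mul α q neg (fun a ha => ((mem_arcs P).1 (hN ha)).1) hk, ones_of_one hε,
    Finset.prod_insert (by simp), prod_ones_castSucc bar x A neg hP hk,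
    blockScalar_last_part bar x A (arcEmb_mem_addArc N k neg) hk', arcOp_addArc, coeff]
  ring

theorem coeff_prime (hε : ε (Fin.last n) ≠ Letter.one) (hP : Fits (fun i => ε i.castSucc) P)
    (hk : k ∈ openTops (fun i => ε i.castSucc) P) (hN : N ⊆ arcs P) :
    coeff α q bar x A ε (addLast P (P.part k)) (addArc N k neg) =
      coeff α q bar (fun i => x i.castSucc) (fun i => A i.castSucc)
        (fun i => ε i.castSucc) P N *
      newWeight α q neg ((openTops (fun i => ε i.castSucc) P).filter (k < ·)).card
        ((openTops (fun i => ε i.castSucc) P).filter (· < k)).card := by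
  have hk' := (mem_openTops.1 hk).1
  have hB := isBlockOrEmpty_part P k
  rw [coeff, arcs_addLast_part P hk', openTops_addLast_of_ne_one hB hε, openTops_filter_part hk,
    qExp_insert_last, newWeight_mul α q neg (fun a ha => ((mem_arcs P).1 (hN ha)).1) hk,
    ones_of_ne_one hε, prod_ones_castSucc bar x A neg hP hk, coeff]
  ring

theorem tensorPart_one (hε : ε (Fin.last n) = Letter.one)
    (hk : k ∈ openTops (fun i => ε i.castSucc) P) :
    tensorPart bar x A ε (addLast P (P.part k)) (addArc N k neg) =
      pureTensor ((((openTops (fun i => ε i.castSucc) P).erase k).sort (fun a b => a ≤ b)).map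
        (blockVec bar (fun i => x i.castSucc) (fun i => A i.castSucc) P N)) := by
  have hB := isBlockOrEmpty_part P k
  rw [tensorPart, openTops_addLast_of_one hB hε, openTops_filter_part hk]
  exact tens_map_castSucc _ _ _ fun i hi => blockVec_castSucc bar x A (arcEmb_mem_addArc N k neg)
    hB (notMem_part_of_mem_erase hk hi)

theorem tensorPart_prime (hε : ε (Fin.last n) ≠ Letter.one)
    (hk : k ∈ openTops (fun i => ε i.castSucc) P) :
    tensorPart bar x A ε (addLast P (P.part k)) (addArc N k neg) =
      pureTensor ((((openTops (fun i => ε i.castSucc) P).erase k).sort (fun a b => a ≤ b)).map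
        (blockVec bar (fun i => x i.castSucc) (fun i => A i.castSucc) P N) ++
        [A (Fin.last n) (newColor bar neg
          (blockVec bar (fun i => x i.castSucc) (fun i => A i.castSucc) P N k))]) := by
  have hB := isBlockOrEmpty_part P k
  rw [tensorPart, openTops_addLast_of_ne_one hB hε, openTops_filter_part hk, tens_insert_last _
    (blockVec bar (fun i => x i.castSucc) (fun i => A i.castSucc) P N),
    blockVec_last_part bar x A (arcEmb_mem_addArc N k neg) (mem_openTops.1 hk).1, arcOp_addArc]
  exact fun i hi => blockVec_castSucc bar x A (arcEmb_mem_addArc N k neg)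
    hB (notMem_part_of_mem_erase hk hi)

/-- Adding a letter to the word. -/
theorem bOp_sum :
    bOp α q bar (x (Fin.last n)) (A (Fin.last n)) (ε (Fin.last n))
        (∑ P ∈ fitting fun i => ε i.castSucc, ∑ N ∈ (arcs P).powerset,
          coeff α q bar (fun i => x i.castSucc) (fun i => A i.castSucc)
            (fun i => ε i.castSucc) P N •
          tensorPart bar (fun i => x i.castSucc) (fun i => A i.castSucc)
            (fun i => ε i.castSucc) P N) =
      ∑ P ∈ fitting ε, ∑ N ∈ (arcs P).powerset,
        coeff α q bar x A ε P N • tensorPart bar x A ε P N := by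
  simp only [map_sum, map_smul]
  by_cases hs : ε (Fin.last n) = Letter.star
  · rw [sum_fitting_star hs]
    refine Finset.sum_congr rfl fun P _ => ?_
    rw [arcs_addLast_empty, sum_powerset_map]
    refine Finset.sum_congr rfl fun N _ => ?_
    rw [coeff_star α q bar x A hs, tensorPart_star bar x A hs, hs]
    rfl
  · rw [sum_fitting_join hs]
    refine Finset.sum_congr rfl fun P hP => ?_
    rw [mem_fitting] at hP
    have hsum : ∀ k ∈ openTops (fun i => ε i.castSucc) P,
        ∑ N ∈ (arcs (addLast P (P.part k))).powerset,
          coeff α q bar x A ε (addLast P (P.part k)) N •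
            tensorPart bar x A ε (addLast P (P.part k)) N =
        ∑ N ∈ (arcs P).powerset, ∑ neg : Bool,
          coeff α q bar x A ε (addLast P (P.part k)) (addArc N k neg) •
            tensorPart bar x A ε (addLast P (P.part k)) (addArc N k neg) := fun k hk => by
      rw [arcs_addLast_part P (mem_openTops.1 hk).1, sum_powerset_addArc]
    -- With `P` and `N` fixed outside, the inner sums over `k` and the colour are those in the
    -- expansion of the operator on one tensor.
    rw [Finset.sum_congr rfl hsum, Finset.sum_comm]
    refine Finset.sum_congr rfl fun N hN => ?_
    rw [Finset.mem_powerset] at hN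
    by_cases h1 : ε (Fin.last n) = Letter.one
    · rw [h1, tensorPart, bOp_one_tens, Finset.smul_sum]
      refine Finset.sum_congr rfl fun k hk => ?_
      rw [Finset.smul_sum]
      refine Finset.sum_congr rfl fun neg _ => ?_
      rw [coeff_one α q bar x A neg h1 hP hk hN, tensorPart_one bar x A neg h1 hk, smul_smul]
    · rw [Letter.eq_prime_iff.2 ⟨hs, h1⟩, tensorPart, bOp_prime_tens, Finset.smul_sum]
      refine Finset.sum_congr rfl fun k hk => ?_
      rw [Finset.smul_sum]
      refine Finset.sum_congr rfl fun neg _ => ?_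
      rw [coeff_prime α q bar x A neg h1 hP hk hN, tensorPart_prime bar x A neg h1 hk, smul_smul]

end Terms

/-! ### Induction on the length of the word -/

theorem fitting_zero (ε : Fin 0 → Letter) : fitting ε = Finset.univ := by
  ext P
  simp only [mem_fitting, Finset.mem_univ, iff_true]
  exact fun i => i.elim0

theorem prod_bOp_vacuum (α q : ℝ) (bar : H →L[ℂ] H) {n : ℕ} (x : Fin n → H)
    (A : Fin n → H →L[ℂ] H) (ε : Fin n → Letter) :
    (List.ofFn fun i : Fin n => bOp α q bar (x i) (A i) (ε i)).reverse.prod vacuum =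
      ∑ P ∈ fitting ε, ∑ N ∈ (arcs P).powerset,
        coeff α q bar x A ε P N • tensorPart bar x A ε P N := by
  induction n with
  | zero =>
    have : Subsingleton (SetPartition 0) := ⟨fun P Q => setPartition_ext fun i => i.elim0⟩
    have hO : ∀ P : SetPartition 0, openTops ε P = ∅ := fun P => Finset.eq_empty_of_isEmpty _
    have ho : ones ε = ∅ := Finset.eq_empty_of_isEmpty _
    have hE : ∀ P : SetPartition 0, arcs P = ∅ := fun P => Finset.eq_empty_of_isEmpty _
    rw [fitting_zero, Fintype.sum_subsingleton _ (⊥ : SetPartition 0)]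
    simp [hE, coeff, tensorPart, hO, ho, qExp, tens, vacuum]
  | succ n ih =>
    -- The list is reversed, so the operator of the last letter is leftmost and acts last; the
    -- induction therefore splits the word at its end.
    rw [List.ofFn_succ', List.concat_eq_append, List.reverse_append, List.prod_append,
      Module.End.mul_apply, ih, ← bOp_sum]
    simp

end TypeB

end

theorem mainTheorem2 {HR H : Type*}
    [NormedAddCommGroup HR] [InnerProductSpace ℝ HR] [CompleteSpace HR]
    [TopologicalSpace.SeparableSpace HR]
    [NormedAddCommGroup H] [InnerProductSpace ℂ H] [CompleteSpace H]
    (ι : HR →ₗ[ℝ] H) (hι : TypeB.IsComplexification ι)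
    (bar : H →L[ℂ] H) (hbar_selfAdjoint : IsSelfAdjoint bar)
    (hbar_involutive : Function.Involutive bar)
    (T : HR → H →L[ℂ] H) (hT : ∀ y : HR, IsSelfAdjoint (T y))
    (α q : ℝ) (hα : α ∈ Set.Ioo (-1 : ℝ) 1) (hq : q ∈ Set.Ioo (-1 : ℝ) 1)
    (n : ℕ) (x : Fin n → HR) (ε : Fin n → TypeB.Letter) :
    -- the product `b^{ε(n)}(xₙ) ⋯ b^{ε(1)}(x₁)`, applied to `Ω`
    (List.ofFn fun i : Fin n => TypeB.bOp α q bar (ι (x i)) (T (x i)) (ε i)).reverse.prod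
        TypeB.vacuum =
      ∑ π ∈ TypeB.ExtPartition.ofWord ε,
        ((α : ℂ) ^ π.Narc * (q : ℂ) ^ (π.rc + π.MaxC + 2 * π.rnarc + 2 * π.MaxL) *
            π.R bar (fun i => ι (x i)) (fun i => T (x i))) •
          π.hatR bar (fun i => ι (x i)) (fun i => T (x i)) := by
  rw [TypeB.sum_ofWord_eq]
  exact TypeB.prod_bOp_vacuum α q bar (fun i => ι (x i)) (fun i => T (x i)) ε
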